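/- **Setting.** Let $n,d_1,d_2\ge 1$ with $nd_1d_2\ge 2$, and let $D_n=((X_k,Y_k))_{k\le n}$ be i.i.d. copies of $(X,Y)\sim\mathbb P$ with values in $([d_1]\times[d_2])\times\{-1,+1\}$. A matrix $M\in\mathbb R^{d_1\times d_2}$ predicts $Y$ by $\mathrm{sign}(M_X)\in\{-1,1\}$ (with $\mathrm{sign}(0)=1$). Put $R_{0/1}(M)=\mathbb P(Y\ne\mathrm{sign}(M_X))$, $R^*_{0/1}=\inf_f\mathbb P(Y\neq f(X))$ over all $f:[d_1]\times[d_2]\to\{-1,1\}$, $R^h(M)=\mathbb E(1-YM_X)_+$ and $r_n^h(M)=\frac1n\sum_{k}(1-Y_kM_{X_k})_+$. Write $p(x)=\mathbb P(Y=1\mid X=x)$. *Prior.* The parameter is $\theta=(L,R,\gamma)\in\mathbb R^{d_1\times m}\times\mathbb R^{d_2\times m}\times\mathbb R^m$, with predictor $M_\theta=LR^\top$. In the hierarchical model the $\gamma_k$ are i.i.d. from $\pi^\gamma$, which is either the Gamma distribution (shape $a$, rate $b$) or the inverse-Gamma distribution (shape $a$, scale $b$) and, given $\gamma$, the rows of $L$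 and $R$ are i.i.d. $\mathcal N(0,\mathrm{diag}(\gamma))$. For $B\ge2$ let $\Theta$ be the set of all $\theta$ for which the hinge loss takes values in $[0,B]$, that is $(1-y(LR^\top)_{ij})_+\le B$ for all $i,j$ and $y=\pm1$. The prior $\pi$ is the law of the hierarchical model conditioned on $\Theta$. *Posterior, VB approximation, estimators.* For $\lambda>0$ let $\hat\rho_\lambda(d\theta)\propto\exp[-\lambda r_n^h(LR^\top)]\,\pi(d\theta)$. Let $\mathcal F$ be a family of probability distributions on the parameter space that contains all the fully factorized ones (all coordinates of $L,R,\gamma$ independent), and let $\tilde\rho_\lambda\in\arg\min_{\rho\in\mathcal F}\mathcal K(\rho\|\hat\rho_\lambda)$, for each sample. The estimator $\hat\theta$ is the mean of $LR^\top$, either under $\tilde\rho_\lambda$ or under $\hat\rho_\lambda$. *Assumptions.* (i) $M^*=\bar U\bar V^\top$ is a Bayes matrix: its entries are $\pm1$ and $M^*_x=\mathrm{sign}\,\mathbb E(Y\mid X=x)$ wherever this conditional expectation is defined and nonzero. Here $\bar U\in\mathbb R^{d_1\times m}$ and $\bar V\in\mathbb R^{d_2\times m}$ have entries bounded by $A>0$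 in absolute value, and only their first $r$ columns may be nonzero, $r\ge1$. (ii) Bernstein condition: for some $K>0$ and all $\theta\in\Theta$, $\mathbb E[(M_{\theta,X}-M^*_X)^2]\le K\,[R^h(M_\theta)-R^h(M^*)]$. (It is implied by the same inequality with $\|M_\theta-M^*\|_F^2$ on the left.) (iii) Margin condition: $\mathbb P\{0<|p(X)-1/2|<1/(2c)\}=0$ for some $c>0$. (iv) With a constant $\kappa\ge1$: $\frac{1}{\kappa\,(nd_1d_2)^{\kappa}}\le b\le\kappa$, and one of the following holds: $m\le\kappa r$; or $m\le\kappa(d_1+d_2)$ and either $\pi^\gamma$ is the Gamma distribution or $b\le\kappa (nd_1d_2)^{-4}$. (For fixed $m$ and $b$ this always holds, with $\kappa=\max(m,b,1/b,1)$.) **Theorem.** For all $K>0$, $B\ge2$, $A>0$, $a>0$, $\kappa\ge1$ there is a constant $C>0$, depending on these numbers only, such that in the setting above, with $\lambda=n/\max(2K,B)$, $$\mathbb E\big[\mathbb E_{\theta\sim\tilde\rho_\lambda}[R_{0/1}(M_\theta)]\big]-R^*_{0/1}\le C\,\frac{r(d_1+d_2)\log(nd_1d_2)}{n}$$ and, for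 both choices of the estimator $\hat\theta$, $$\mathbb E[R_{0/1}(\hat\theta)]-R^*_{0/1}\le C\,\frac{r(d_1+d_2)\log(nd_1d_2)}{n}.$$ -/

import Mathlib

open MeasureTheory ProbabilityTheory
open scoped ENNReal

noncomputable section

namespace OneBit

/-- Positions in a `d1 × d2` matrix (the covariates). -/
abbrev Cell (d1 d2 : ℕ) : Type := Fin d1 × Fin d2

/-- One observation `(X, Y)`: a position and a label, `true` standing for `+1` and `false` for
`-1`. -/
abbrev Obs (d1 d2 : ℕ) : Type := Cell d1 d2 × Bool

/-- The numerical value `±1` of a label. -/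
def labelVal (y : Bool) : ℝ := if y then 1 else -1

/-- The sign of a real number, as a label (the value at `0` is `+1`). -/
def sgn (t : ℝ) : Bool := decide (0 ≤ t)

/-! ### The law of one observation -/

/-- The probability `p(x) = ℙ(Y = 1 ∣ X = x)`. -/
def condProb {d1 d2 : ℕ} (P : Measure (Obs d1 d2)) (x : Cell d1 d2) : ℝ :=
  P.real {(x, true)} / P.real {z | z.1 = x}

/-- The regression function `η(x) = 𝔼(Y ∣ X = x)` (it is `0` at the positions that are never
observed). -/
def regression {d1 d2 : ℕ} (P : Measure (Obs d1 d2)) (x : Cell d1 d2) : ℝ :=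
  (P.real {(x, true)} - P.real {(x, false)}) / P.real {z | z.1 = x}

/-- `M = sign η` with values in `{-1, 1}`; where `η = 0` either sign is allowed. -/
def IsBayesMatrix {d1 d2 : ℕ} (P : Measure (Obs d1 d2)) (M : Matrix (Fin d1) (Fin d2) ℝ) : Prop :=
  ∀ i j, (M i j = 1 ∨ M i j = -1) ∧
    (0 < regression P (i, j) → M i j = 1) ∧ (regression P (i, j) < 0 → M i j = -1)

/-- The margin (low-noise) condition with constant `c`. -/
def MarginCondition {d1 d2 : ℕ} (P : Measure (Obs d1 d2)) (c : ℝ) : Prop :=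
  P {z | 0 < |condProb P z.1 - 1 / 2| ∧ |condProb P z.1 - 1 / 2| < 1 / (2 * c)} = 0

/-! ### Risks -/

/-- Misclassification risk `ℙ(Y ≠ sign M_X)` of the classifier `sign M`. It is at least
`ℙ(Y * M_X < 0)`. -/
def misclassRisk {d1 d2 : ℕ} (P : Measure (Obs d1 d2)) (M : Matrix (Fin d1) (Fin d2) ℝ) : ℝ :=
  P.real {z | z.2 ≠ sgn (M z.1.1 z.1.2)}

/-- The Bayes risk: the least misclassification probability over all classifiers. -/
def bayesRisk {d1 d2 : ℕ} (P : Measure (Obs d1 d2)) : ℝ :=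
  ⨅ f : Cell d1 d2 → Bool, P.real {z | z.2 ≠ f z.1}

/-- The hinge loss `(1 - y t)₊`. -/
def hinge (y t : ℝ) : ℝ := max (1 - y * t) 0

/-- The hinge risk `𝔼 (1 - Y M_X)₊`. -/
def hingeRisk {d1 d2 : ℕ} (P : Measure (Obs d1 d2)) (M : Matrix (Fin d1) (Fin d2) ℝ) : ℝ :=
  ∫ z, hinge (labelVal z.2) (M z.1.1 z.1.2) ∂P

/-- The empirical hinge risk of a sample of size `n`. -/
def empHingeRisk {d1 d2 n : ℕ} (D : Fin n → Obs d1 d2) (M : Matrix (Fin d1) (Fin d2) ℝ) : ℝ :=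
  (1 / (n : ℝ)) * ∑ k, hinge (labelVal (D k).2) (M (D k).1.1 (D k).1.2)

/-- The squared distance `𝔼 (M_X - M'_X)²` between two predictors, in `L²` of the law of `X`.
It is at most the squared Frobenius distance. -/
def sqDist {d1 d2 : ℕ} (P : Measure (Obs d1 d2)) (M M' : Matrix (Fin d1) (Fin d2) ℝ) : ℝ :=
  ∫ z, (M z.1.1 z.1.2 - M' z.1.1 z.1.2) ^ 2 ∂P

/-! ### Parameters and prior -/

/-- Parameters `θ = (L, R, γ)`: the two factors (with `m` columns) and the column variances. -/
abbrev Params (d1 d2 m : ℕ) : Type :=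
  (Fin d1 → Fin m → ℝ) × (Fin d2 → Fin m → ℝ) × (Fin m → ℝ)

/-- The matrix `L Rᵀ` of the parameter `(L, R, γ)`. -/
def toMatrix {d1 d2 m : ℕ} (θ : Params d1 d2 m) : Matrix (Fin d1) (Fin d2) ℝ :=
  Matrix.of θ.1 * (Matrix.of θ.2.1).transpose

/-- The two families of laws for the variances. -/
inductive VarianceFamily
  | gamma
  | invGamma

/-- Density of the inverse-Gamma distribution with shape `a` and scale `b`. -/
def invGammaPDF (a b x : ℝ) : ℝ≥0∞ :=
  ENNReal.ofReal (if 0 < x then b ^ a / Real.Gamma a * x ^ (-a - 1) * Real.exp (-(b / x)) else 0)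

/-- Density of the law `π^γ`: Gamma with shape `a` and rate `b`, or inverse-Gamma with shape `a`
and scale `b`. -/
def variancePDF : VarianceFamily → ℝ → ℝ → ℝ → ℝ≥0∞
  | .gamma, a, b, x => gammaPDF a b x
  | .invGamma, a, b, x => invGammaPDF a b x

/-- Joint law of the hierarchical model: the `γ k` are i.i.d. from `π^γ` and, given `γ`, the rows of
`L` and `R` are i.i.d. from `𝒩(0, diag γ)`. -/
def hierarchicalPrior (d1 d2 m : ℕ) (fam : VarianceFamily) (a b : ℝ) : Measure (Params d1 d2 m) :=
  (volume : Measure (Params d1 d2 m)).withDensity fun θ =>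
    ∏ k, (variancePDF fam a b (θ.2.2 k) *
      (∏ i, gaussianPDF 0 (θ.2.2 k).toNNReal (θ.1 i k)) *
      (∏ j, gaussianPDF 0 (θ.2.2 k).toNNReal (θ.2.1 j k)))

/-- The parameter set `Θ`: the parameters for which the hinge loss takes its values in `[0, B]`,
for both labels and at every position. -/
def paramSet (d1 d2 m : ℕ) (B : ℝ) : Set (Params d1 d2 m) :=
  {θ | ∀ (i : Fin d1) (j : Fin d2) (y : Bool), hinge (labelVal y) (toMatrix θ i j) ≤ B}

/-- The prior on `Θ`: the hierarchical law conditioned on `Θ`. -/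
def prior (d1 d2 m : ℕ) (fam : VarianceFamily) (a b B : ℝ) : Measure (Params d1 d2 m) :=
  cond (hierarchicalPrior d1 d2 m fam a b) (paramSet d1 d2 m B)

/-! ### Gibbs posterior and variational approximation -/

/-- The Gibbs posterior `∝ exp (-lam * r_n^h(L Rᵀ)) π(dθ)`. -/
def gibbs {d1 d2 m n : ℕ} (π : Measure (Params d1 d2 m)) (lam : ℝ) (D : Fin n → Obs d1 d2) :
    Measure (Params d1 d2 m) :=
  π.tilted fun θ => -lam * empHingeRisk D (toMatrix θ)

/-- The fully factorized distributions of `(L, R, γ)`: all coordinates are independent. -/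
def fullyFactorized (d1 d2 m : ℕ) : Set (Measure (Params d1 d2 m)) :=
  {ρ | ∃ (p : Fin d1 → Fin m → Measure ℝ) (q : Fin d2 → Fin m → Measure ℝ) (g : Fin m → Measure ℝ),
    (∀ i k, IsProbabilityMeasure (p i k)) ∧ (∀ j k, IsProbabilityMeasure (q j k)) ∧
    (∀ k, IsProbabilityMeasure (g k)) ∧
    ρ = (Measure.pi fun i => Measure.pi (p i)).prod
      ((Measure.pi fun j => Measure.pi (q j)).prod (Measure.pi g))}

/-- `ρ` is a minimizer over the family `F` of the Kullback-Leibler divergence to `ν`. -/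
def IsVBApprox {d1 d2 m : ℕ} (F : Set (Measure (Params d1 d2 m))) (ν ρ : Measure (Params d1 d2 m)) :
    Prop :=
  ρ ∈ F ∧ ∀ ρ' ∈ F, InformationTheory.klDiv ρ ν ≤ InformationTheory.klDiv ρ' ν

/-- The mean estimator: the mean of the matrix `L Rᵀ` under `ρ`. -/
def meanMatrix {d1 d2 m : ℕ} (ρ : Measure (Params d1 d2 m)) : Matrix (Fin d1) (Fin d2) ℝ :=
  Matrix.of fun i j => ∫ θ, toMatrix θ i j ∂ρ

/-- The class of pairs of factors with entries bounded by `A` in absolute value, in which only the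
first `r` columns may be nonzero. -/
def factorClass (d1 d2 m r : ℕ) (A : ℝ) :
    Set (Matrix (Fin d1) (Fin m) ℝ × Matrix (Fin d2) (Fin m) ℝ) :=
  {W | (∀ i k, |W.1 i k| ≤ A) ∧ (∀ j k, |W.2 j k| ≤ A) ∧
    (∀ i (k : Fin m), r ≤ (k : ℕ) → W.1 i k = 0) ∧
    (∀ j (k : Fin m), r ≤ (k : ℕ) → W.2 j k = 0)}

end OneBit

end

/-! The excess 0-1 risk is at most the excess hinge risk (`misclassRisk_sub_bayesRisk_le`), and the
hinge risk is convex, so the mean matrix does no worse than the randomized predictor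
(`hingeRisk_meanMatrix_le`). It remains to bound the mean excess hinge risk under the posterior or
its approximation.

This is a localized PAC-Bayes argument (`integral_excess_le_of_klDiv_le`). The minimizer over `F` is
at least as close to the Gibbs posterior as any factorized law `ρ'`. If `ρ'` has density at most
`exp c` with respect to the prior and is carried by parameters whose matrix is within `δ` of the
Bayes matrix entrywise, the Donsker-Varadhan inequality bounds the expected excess by `2 * (c / lam
+ δ)`. The Bernstein condition enters through an exponential moment that is at most 1: for this
choice of `lam` the second-order term eats at most half of the mean. The Gibbs posterior is covered
too, being at divergence zero from itself.

Everything then rests on a factorized competitor with `c` of order `r (d1 + d2) log (n d1 d2)`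
(`exists_competitor`). In the at most `κ r` active columns the entries are uniform on small windows
around the given factors and the variances lie in `[1, 2]`; each of the `d1 + d2` entries costs a
logarithm. There may be `κ (d1 + d2)` other columns, so each of them can afford one logarithm in
all. Their entries therefore keep a Gaussian shape, with tiny variance and truncated, while the
variance coordinate is confined to a window of relative width `1 / (d1 + d2)`. An entry then costs
only `2 / (d1 + d2)`, and the logarithm pays for putting the variance in its window. The
inverse-Gamma density is of order `exp (-b / x)` near zero, which is why it requires a small `b`
there. -/

namespace OneBit

/-! ### Kullback-Leibler divergence and the localized variational inequality. -/

section KullbackLeibler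

open InformationTheory

variable {α : Type*} {mα : MeasurableSpace α}

/-- A bound on the density bounds the Kullback-Leibler divergence. -/
lemma klDiv_le_of_le_smul {ρ μ : Measure α} [IsProbabilityMeasure ρ] [IsProbabilityMeasure μ]
    {C : ℝ} (h : ρ ≤ ENNReal.ofReal (Real.exp C) • μ) : klDiv ρ μ ≤ ENNReal.ofReal C := by
  have hac : ρ ≪ μ := (Measure.absolutelyContinuous_of_le h).trans
    Measure.smul_absolutelyContinuous
  have hd : ∀ᵐ x ∂μ, (ρ.rnDeriv μ x).toReal ≤ Real.exp C := by
    have h1 : ρ.rnDeriv μ ≤ᵐ[μ] fun _ => ENNReal.ofReal (Real.exp C) := by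
      refine ae_le_of_forall_setLIntegral_le_of_sigmaFinite (Measure.measurable_rnDeriv _ _)
        fun s hs _ => ?_
      rw [Measure.setLIntegral_rnDeriv hac, setLIntegral_const]
      exact h s
    filter_upwards [h1] with x hx
    exact ENNReal.toReal_le_of_le_ofReal (Real.exp_pos _).le hx
  rw [klDiv_eq_lintegral_klFun_of_ac hac]
  have hint : Integrable (fun x => (ρ.rnDeriv μ x).toReal) μ := Measure.integrable_toReal_rnDeriv
  -- `klFun t = t * log t + 1 - t`; with `log t ≤ C` the majorant is affine in the density, whose
  -- total mass is 1, so it integrates to `C`.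
  have hb : ∀ᵐ x ∂μ, klFun (ρ.rnDeriv μ x).toReal ≤
      (ρ.rnDeriv μ x).toReal * C + 1 - (ρ.rnDeriv μ x).toReal := by
    filter_upwards [hd] with x hx
    rw [klFun_apply]
    rcases eq_or_lt_of_le (ENNReal.toReal_nonneg (a := ρ.rnDeriv μ x)) with h0 | h0
    · simp [← h0]
    · have : Real.log (ρ.rnDeriv μ x).toReal ≤ C := by
        rw [← Real.log_exp C]; exact Real.log_le_log h0 hx
      nlinarith
  have hint2 : Integrable (fun x =>
      (ρ.rnDeriv μ x).toReal * C + 1 - (ρ.rnDeriv μ x).toReal) μ :=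
    ((hint.mul_const C).add (integrable_const 1)).sub hint
  calc ∫⁻ x, ENNReal.ofReal (klFun (ρ.rnDeriv μ x).toReal) ∂μ
      ≤ ∫⁻ x, ENNReal.ofReal
          ((ρ.rnDeriv μ x).toReal * C + 1 - (ρ.rnDeriv μ x).toReal) ∂μ := by
        refine lintegral_mono_ae ?_
        filter_upwards [hb] with x hx
        exact ENNReal.ofReal_le_ofReal hx
    _ = ENNReal.ofReal (∫ x,
          ((ρ.rnDeriv μ x).toReal * C + 1 - (ρ.rnDeriv μ x).toReal) ∂μ) := by
        rw [ofReal_integral_eq_lintegral_ofReal hint2]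
        filter_upwards [hb] with x hx
        exact (klFun_nonneg ENNReal.toReal_nonneg).trans hx
    _ = ENNReal.ofReal C := by
        congr 1
        have hint3 : Integrable (fun x => (ρ.rnDeriv μ x).toReal * C + 1) μ :=
          (hint.mul_const C).add (integrable_const 1)
        rw [integral_sub hint3 hint, integral_add (hint.mul_const C) (integrable_const 1),
          integral_mul_const, Measure.integral_toReal_rnDeriv hac]
        simp

/-- The Donsker-Varadhan inequality. -/
lemma integral_le_klDiv_add_log {ρ μ : Measure α} [IsProbabilityMeasure ρ]
    [IsProbabilityMeasure μ] {g : α → ℝ} (hkl : klDiv ρ μ ≠ ∞) (hg : Integrable g ρ)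
    (hexp : Integrable (fun x => Real.exp (g x)) μ) :
    ∫ x, g x ∂ρ ≤ (klDiv ρ μ).toReal + Real.log (∫ x, Real.exp (g x) ∂μ) := by
  obtain ⟨hac, hllr⟩ := klDiv_ne_top_iff.mp hkl
  have := isProbabilityMeasure_tilted hexp
  have h1 := integral_llr_add_sub_measure_univ_nonneg
    (hac.trans (absolutelyContinuous_tilted hexp))
    (integrable_llr_tilted_right hac hg hllr hexp)
  rw [integral_llr_tilted_right hac hg hexp hllr] at h1
  rw [toReal_klDiv_of_measure_eq hac (by simp)]
  simp only [probReal_univ] at h1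
  linarith

/-- Localization of the PAC-Bayes bound: if `ρ` is at least as close to the Gibbs measure of the
loss `f` as some `ρ'` whose density with respect to `π` is at most `exp c` and which is carried by
`{f ≤ b}`, then the integrals of `g` under `ρ` are controlled by an exponential moment. -/
lemma integral_le_of_klDiv_tilted_le {π ρ ρ' : Measure α} [IsProbabilityMeasure π]
    [IsProbabilityMeasure ρ] [IsProbabilityMeasure ρ'] {f g : α → ℝ} {b c G H : ℝ}
    (hf : Measurable f) (hg : Measurable g) (hfb : ∀ᵐ x ∂π, |f x| ≤ H)
    (hgb : ∀ᵐ x ∂π, |g x| ≤ G)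
    (hρ' : ρ' ≤ ENNReal.ofReal (Real.exp c) • π) (hρ'b : ∀ᵐ x ∂ρ', f x ≤ b)
    (hkl : klDiv ρ (π.tilted fun x => -f x) ≤ klDiv ρ' (π.tilted fun x => -f x)) :
    (ρ ≪ π) ∧ ∫ x, g x ∂ρ ≤ c + b + Real.log (∫ x, Real.exp (g x - f x) ∂π) := by
  have hexpf : Integrable (fun x => Real.exp (-f x)) π := by
    refine Integrable.of_bound (C := Real.exp H) (by fun_prop) ?_
    filter_upwards [hfb] with x hx
    rw [Real.norm_eq_abs, Real.abs_exp]
    exact Real.exp_le_exp.mpr ((neg_le_abs _).trans hx)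
  have := isProbabilityMeasure_tilted hexpf
  set Z := ∫ x, Real.exp (-f x) ∂π with hZ
  have hZpos : 0 < Z := integral_exp_pos hexpf
  -- On `{f ≤ b}` the Gibbs density with respect to `π` is at least `exp (-b) / Z`, so passing from
  -- `π` to the Gibbs measure multiplies the density bound by `Z * exp b`.
  have hle : ρ' ≤ ENNReal.ofReal (Real.exp (c + b + Real.log Z)) •
      (π.tilted fun x => -f x) := by
    refine Measure.le_iff.mpr fun s hs => ?_
    have hG : MeasurableSet {x | f x ≤ b} := hf measurableSet_Iic
    have e1 : ρ' s = ρ' (s ∩ {x | f x ≤ b}) := by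
      refine measure_congr ?_
      filter_upwards [hρ'b] with x hx
      simp only [eq_iff_iff]
      exact ⟨fun h => ⟨h, hx⟩, fun h => h.1⟩
    have e2 : ENNReal.ofReal (Real.exp (-b) / Z) * π (s ∩ {x | f x ≤ b}) ≤
        (π.tilted fun x => -f x) (s ∩ {x | f x ≤ b}) := by
      rw [tilted_apply' _ _ (hs.inter hG), ← setLIntegral_const]
      refine setLIntegral_mono' (hs.inter hG) fun x hx => ENNReal.ofReal_le_ofReal ?_
      have : f x ≤ b := hx.2
      gcongr
    have e3 : ENNReal.ofReal (Real.exp c) = ENNReal.ofReal (Real.exp (c + b + Real.log Z)) *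
        ENNReal.ofReal (Real.exp (-b) / Z) := by
      rw [← ENNReal.ofReal_mul (Real.exp_pos _).le, Real.exp_add, Real.exp_log hZpos,
        Real.exp_add, Real.exp_neg]
      congr 1
      field_simp
    calc ρ' s = ρ' (s ∩ {x | f x ≤ b}) := e1
      _ ≤ ENNReal.ofReal (Real.exp c) * π (s ∩ {x | f x ≤ b}) := by
        simpa using hρ' (s ∩ {x | f x ≤ b})
      _ = ENNReal.ofReal (Real.exp (c + b + Real.log Z)) *
          (ENNReal.ofReal (Real.exp (-b) / Z) * π (s ∩ {x | f x ≤ b})) := by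
        rw [e3, mul_assoc]
      _ ≤ ENNReal.ofReal (Real.exp (c + b + Real.log Z)) *
          (π.tilted fun x => -f x) (s ∩ {x | f x ≤ b}) := by gcongr
      _ ≤ ENNReal.ofReal (Real.exp (c + b + Real.log Z)) *
          (π.tilted fun x => -f x) s := by gcongr; exact Set.inter_subset_left
      _ = _ := by simp
  have hkl' := hkl.trans (klDiv_le_of_le_smul hle)
  have hne : klDiv ρ (π.tilted fun x => -f x) ≠ ∞ := ne_top_of_le_ne_top ENNReal.ofReal_ne_top hkl'
  have hρπ : ρ ≪ π := (klDiv_ne_top_iff.mp hne).1.trans (tilted_absolutelyContinuous _ _)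
  refine ⟨hρπ, ?_⟩
  have hgexp : ∀ᵐ x ∂(π.tilted fun x => -f x), |g x| ≤ G := (tilted_absolutelyContinuous _ _) hgb
  have hdv := integral_le_klDiv_add_log hne (g := g)
    (Integrable.of_bound hg.aestronglyMeasurable G (hρπ hgb))
    (by
      refine Integrable.of_bound (C := Real.exp G) (by fun_prop) ?_
      filter_upwards [hgexp] with x hx
      rw [Real.norm_eq_abs, Real.abs_exp]
      exact Real.exp_le_exp.mpr ((le_abs_self _).trans hx))
  have hfg : Integrable (fun x => Real.exp (-f x + g x)) π := by
    refine Integrable.of_bound (C := Real.exp (H + G)) (by fun_prop) ?_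
    filter_upwards [hfb, hgb] with x hx hx'
    rw [Real.norm_eq_abs, Real.abs_exp]
    exact Real.exp_le_exp.mpr (by linarith [neg_le_abs (f x), le_abs_self (g x)])
  -- `log Z` enters here with the sign opposite to that in the divergence bound, so the normalizing
  -- constant cancels and never has to be estimated.
  have hlog : Real.log (∫ x, Real.exp (g x) ∂(π.tilted fun x => -f x)) =
      Real.log (∫ x, Real.exp (g x - f x) ∂π) - Real.log Z := by
    rw [integral_exp_tilted, Real.log_div]
    · simp only [Pi.add_apply, neg_add_eq_sub, ← hZ]
    · exact (integral_exp_pos hfg).ne'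
    · exact hZpos.ne'
  -- `ENNReal.ofReal` truncates at zero, so the sign matters: comparing total masses in `hle` shows
  -- that the exponent is nonnegative.
  have hbound : (0 : ℝ) ≤ c + b + Real.log Z := by
    have h1 := hle Set.univ
    simp only [measure_univ, Measure.smul_apply, smul_eq_mul, mul_one] at h1
    have := ENNReal.one_le_ofReal.mp h1
    exact Real.one_le_exp_iff.mp this
  have hk : (klDiv ρ (π.tilted fun x => -f x)).toReal ≤ c + b + Real.log Z :=
    ENNReal.toReal_le_of_le_ofReal hbound hkl'
  linarith

end KullbackLeibler

/-! ### Risks as sums over cells, and calibration of the hinge loss. -/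

section Risks

variable {d1 d2 : ℕ}

lemma hinge_nonneg (y t : ℝ) : 0 ≤ hinge y t := le_max_right _ _

lemma labelVal_eq (y : Bool) : labelVal y = 1 ∨ labelVal y = -1 := by
  cases y <;> simp [labelVal]

lemma abs_hinge_sub_le (y : Bool) (s t : ℝ) :
    |hinge (labelVal y) s - hinge (labelVal y) t| ≤ |s - t| := by
  have h := abs_max_sub_max_le_abs (1 - labelVal y * s) (1 - labelVal y * t) 0
  refine h.trans (le_of_eq ?_)
  rcases labelVal_eq y with hy | hy <;> rw [hy]
  · rw [← abs_neg]; congr 1; ring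
  · congr 1; ring

@[fun_prop]
lemma measurable_hinge (y : ℝ) : Measurable (hinge y) := by
  unfold hinge; fun_prop

lemma measureReal_ne_eq_sum (P : Measure (Obs d1 d2)) [IsProbabilityMeasure P]
    (f : Cell d1 d2 → Bool) :
    P.real {z | z.2 ≠ f z.1} = ∑ x, if f x then P.real {(x, false)} else P.real {(x, true)} := by
  classical
  rw [← integral_indicator_one (Set.toFinite _).measurableSet, integral_fintype .of_finite,
    Fintype.sum_prod_type]
  refine Finset.sum_congr rfl fun x _ => ?_
  rw [Fintype.sum_bool]
  cases h : f x <;> simp [Set.indicator, h]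

lemma hingeRisk_eq_sum (P : Measure (Obs d1 d2)) [IsProbabilityMeasure P]
    (M : Matrix (Fin d1) (Fin d2) ℝ) :
    hingeRisk P M = ∑ x : Cell d1 d2, (P.real {(x, true)} * max (1 - M x.1 x.2) 0 +
      P.real {(x, false)} * max (1 + M x.1 x.2) 0) := by
  rw [hingeRisk, integral_fintype .of_finite, Fintype.sum_prod_type]
  refine Finset.sum_congr rfl fun x _ => ?_
  rw [Fintype.sum_bool]
  simp [hinge, labelVal]

lemma misclassRisk_eq_sum (P : Measure (Obs d1 d2)) [IsProbabilityMeasure P]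
    (M : Matrix (Fin d1) (Fin d2) ℝ) :
    misclassRisk P M = ∑ x : Cell d1 d2,
      if 0 ≤ M x.1 x.2 then P.real {(x, false)} else P.real {(x, true)} := by
  have := measureReal_ne_eq_sum P fun x => sgn (M x.1 x.2)
  simpa [misclassRisk, sgn] using this

lemma hingeRisk_nonneg (P : Measure (Obs d1 d2)) (M : Matrix (Fin d1) (Fin d2) ℝ) :
    0 ≤ hingeRisk P M := integral_nonneg fun _ => hinge_nonneg _ _

/-- A Bayes matrix has the sign of the difference of the two label masses. -/
lemma IsBayesMatrix.cases {P : Measure (Obs d1 d2)} [IsProbabilityMeasure P]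
    {M : Matrix (Fin d1) (Fin d2) ℝ} (hM : IsBayesMatrix P M) (x : Cell d1 d2) :
    (M x.1 x.2 = 1 ∧ P.real {(x, false)} ≤ P.real {(x, true)}) ∨
      (M x.1 x.2 = -1 ∧ P.real {(x, true)} ≤ P.real {(x, false)}) := by
  obtain ⟨h1, h2, h3⟩ := hM x.1 x.2
  have key : ∀ y : Bool, P.real {(x, y)} ≤ P.real {z | z.1 = x} := fun y =>
    measureReal_mono (by simp)
  -- At a cell of probability zero both label masses vanish, so either sign qualifies.
  rcases (measureReal_nonneg (μ := P) (s := {z | z.1 = x})).eq_or_lt with h0 | h0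
  · have hz : ∀ y : Bool, P.real {(x, y)} = 0 := fun y =>
      le_antisymm ((key y).trans h0.symm.le) measureReal_nonneg
    simpa [hz] using h1
  · rcases lt_trichotomy (P.real {(x, true)}) (P.real {(x, false)}) with h | h | h
    · exact Or.inr ⟨h3 (div_neg_of_neg_of_pos (by simpa using h) h0), h.le⟩
    · rcases h1 with h1 | h1
      · exact Or.inl ⟨h1, h.ge⟩
      · exact Or.inr ⟨h1, h.le⟩
    · exact Or.inl ⟨h2 (div_pos (by simpa using h) h0), h.le⟩

/-- One-cell calibration: `p`, `q` are the masses of the labels `+1`, `-1`, and the Bayes prediction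
`s` has hinge cost `2 * min p q`. A correct sign costs at least this much because the two hinge
terms add up to at least 2; with the sign of the lighter label, the term of the heavier one is at
least 1, and the surplus is at least `|p - q|`. -/
lemma excess_cell_le {p q t s : ℝ} (hp : 0 ≤ p) (hq : 0 ≤ q)
    (hs : (s = 1 ∧ q ≤ p) ∨ (s = -1 ∧ p ≤ q)) :
    (if 0 ≤ t then q else p) - min p q ≤ (p * max (1 - t) 0 + q * max (1 + t) 0) -
      (p * max (1 - s) 0 + q * max (1 + s) 0) := by
  have h1 := le_max_left (1 - t) 0
  have h2 := le_max_right (1 - t) 0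
  have h3 := le_max_left (1 + t) 0
  have h4 := le_max_right (1 + t) 0
  have hsum : 2 ≤ max (1 - t) 0 + max (1 + t) 0 := by linarith
  rcases hs with ⟨rfl, h⟩ | ⟨rfl, h⟩
  · rw [min_eq_right h]
    norm_num
    split_ifs with ht
    · nlinarith
    · push Not at ht
      nlinarith
  · rw [min_eq_left h]
    norm_num
    split_ifs with ht
    · nlinarith
    · nlinarith

/-- The excess misclassification risk is at most the excess hinge risk. -/
lemma misclassRisk_sub_bayesRisk_le (P : Measure (Obs d1 d2)) [IsProbabilityMeasure P]
    {Ms : Matrix (Fin d1) (Fin d2) ℝ} (hMs : IsBayesMatrix P Ms)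
    (M : Matrix (Fin d1) (Fin d2) ℝ) :
    misclassRisk P M - bayesRisk P ≤ hingeRisk P M - hingeRisk P Ms := by
  have hbayes : ∑ x : Cell d1 d2, min (P.real {(x, true)}) (P.real {(x, false)}) ≤
      bayesRisk P := by
    refine le_ciInf fun f => ?_
    rw [measureReal_ne_eq_sum P f]
    refine Finset.sum_le_sum fun x _ => ?_
    split_ifs
    · exact min_le_right _ _
    · exact min_le_left _ _
  rw [misclassRisk_eq_sum, hingeRisk_eq_sum, hingeRisk_eq_sum, ← Finset.sum_sub_distrib]
  refine (sub_le_sub_left hbayes _).trans ?_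
  rw [← Finset.sum_sub_distrib]
  exact Finset.sum_le_sum fun x _ =>
    excess_cell_le measureReal_nonneg measureReal_nonneg (hMs.cases x)

lemma misclassRisk_le_one (P : Measure (Obs d1 d2)) [IsProbabilityMeasure P]
    (M : Matrix (Fin d1) (Fin d2) ℝ) : misclassRisk P M ≤ 1 := measureReal_le_one

lemma misclassRisk_nonneg (P : Measure (Obs d1 d2)) (M : Matrix (Fin d1) (Fin d2) ℝ) :
    0 ≤ misclassRisk P M := measureReal_nonneg

lemma bayesRisk_nonneg (P : Measure (Obs d1 d2)) : 0 ≤ bayesRisk P :=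
  Real.iInf_nonneg fun _ => measureReal_nonneg

end Risks

/-! ### Measurability, the parameter set, and convexity for the mean matrix. -/

section Parameters

variable {d1 d2 m : ℕ}

lemma toMatrix_apply (θ : Params d1 d2 m) (i : Fin d1) (j : Fin d2) :
    toMatrix θ i j = ∑ k, θ.1 i k * θ.2.1 j k := by
  simp [toMatrix, Matrix.mul_apply]

@[fun_prop]
lemma measurable_toMatrix_apply (i : Fin d1) (j : Fin d2) :
    Measurable fun θ : Params d1 d2 m => toMatrix θ i j := by
  simp only [toMatrix_apply]
  fun_prop

@[fun_prop]
lemma measurable_empHingeRisk_toMatrix {n : ℕ} (D : Fin n → Obs d1 d2) :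
    Measurable fun θ : Params d1 d2 m => empHingeRisk D (toMatrix θ) := by
  unfold empHingeRisk
  exact (Finset.measurable_fun_sum _ fun k _ =>
    (measurable_hinge _).comp (measurable_toMatrix_apply _ _)).const_mul _

@[fun_prop]
lemma measurable_hingeRisk_toMatrix (P : Measure (Obs d1 d2)) [IsProbabilityMeasure P] :
    Measurable fun θ : Params d1 d2 m => hingeRisk P (toMatrix θ) := by
  simp only [hingeRisk_eq_sum]
  fun_prop

@[fun_prop]
lemma measurable_misclassRisk_toMatrix (P : Measure (Obs d1 d2)) [IsProbabilityMeasure P] :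
    Measurable fun θ : Params d1 d2 m => misclassRisk P (toMatrix θ) := by
  simp only [misclassRisk_eq_sum]
  exact Finset.measurable_fun_sum _ fun x _ => Measurable.ite
    (measurableSet_le measurable_const (measurable_toMatrix_apply _ _))
    measurable_const measurable_const

lemma measurableSet_paramSet (B : ℝ) : MeasurableSet (paramSet d1 d2 m B) := by
  unfold paramSet
  simp only [Set.ofPred_forall]
  exact .iInter fun i => .iInter fun j => .iInter fun y => measurableSet_le
    ((measurable_hinge _).comp (measurable_toMatrix_apply _ _)) measurable_const

lemma mem_paramSet_of_abs_le {B : ℝ} {θ : Params d1 d2 m}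
    (h : ∀ i j, |toMatrix θ i j| ≤ B - 1) (hB : 0 ≤ B) : θ ∈ paramSet d1 d2 m B := by
  intro i j y
  refine max_le ?_ hB
  have := abs_le.mp (h i j)
  rcases labelVal_eq y with hy | hy <;> rw [hy] <;> linarith

lemma abs_toMatrix_le {B : ℝ} {θ : Params d1 d2 m} (h : θ ∈ paramSet d1 d2 m B)
    (i : Fin d1) (j : Fin d2) : |toMatrix θ i j| ≤ B - 1 := by
  have h1 := (le_max_left _ _).trans (h i j true)
  have h2 := (le_max_left _ _).trans (h i j false)
  simp [labelVal] at h1 h2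
  rw [abs_le]; constructor <;> linarith

lemma hingeRisk_le_of_mem_paramSet {B : ℝ} (P : Measure (Obs d1 d2)) [IsProbabilityMeasure P]
    {θ : Params d1 d2 m} (h : θ ∈ paramSet d1 d2 m B) : hingeRisk P (toMatrix θ) ≤ B := by
  calc hingeRisk P (toMatrix θ) ≤ ∫ _, B ∂P :=
        integral_mono .of_finite .of_finite fun z => h _ _ _
    _ = B := by simp

/-- Jensen's inequality for the hinge risk of the mean estimator. -/
lemma hingeRisk_meanMatrix_le (P : Measure (Obs d1 d2)) [IsProbabilityMeasure P]
    (ρ : Measure (Params d1 d2 m)) [IsProbabilityMeasure ρ]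
    (hint : ∀ i j, Integrable (fun θ => toMatrix θ i j) ρ) :
    hingeRisk P (meanMatrix ρ) ≤ ∫ θ, hingeRisk P (toMatrix θ) ∂ρ := by
  have i1 : ∀ x : Cell d1 d2, Integrable (fun θ => max (1 - toMatrix θ x.1 x.2) 0) ρ :=
    fun x => ((integrable_const 1).sub (hint _ _)).pos_part
  have i2 : ∀ x : Cell d1 d2, Integrable (fun θ => max (1 + toMatrix θ x.1 x.2) 0) ρ :=
    fun x => ((integrable_const 1).add (hint _ _)).pos_part
  have i3 : ∀ x : Cell d1 d2, Integrable (fun θ => P.real {(x, true)} *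
      max (1 - toMatrix θ x.1 x.2) 0 + P.real {(x, false)} * max (1 + toMatrix θ x.1 x.2) 0) ρ :=
    fun x => ((i1 x).const_mul _).add ((i2 x).const_mul _)
  simp only [hingeRisk_eq_sum]
  rw [integral_finsetSum _ fun x _ => i3 x]
  refine Finset.sum_le_sum fun x _ => ?_
  rw [integral_add ((i1 x).const_mul _) ((i2 x).const_mul _), integral_const_mul,
    integral_const_mul]
  refine add_le_add (mul_le_mul_of_nonneg_left ?_ measureReal_nonneg)
    (mul_le_mul_of_nonneg_left ?_ measureReal_nonneg)
  · refine max_le ?_ (integral_nonneg fun _ => le_max_right _ _)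
    calc 1 - meanMatrix ρ x.1 x.2 = ∫ θ, (1 - toMatrix θ x.1 x.2) ∂ρ := by
          rw [integral_sub (integrable_const 1) (hint _ _)]; simp [meanMatrix]
      _ ≤ _ := integral_mono ((integrable_const 1).sub (hint _ _)) (i1 x) fun _ => le_max_left _ _
  · refine max_le ?_ (integral_nonneg fun _ => le_max_right _ _)
    calc 1 + meanMatrix ρ x.1 x.2 = ∫ θ, (1 + toMatrix θ x.1 x.2) ∂ρ := by
          rw [integral_add (integrable_const 1) (hint _ _)]; simp [meanMatrix]
      _ ≤ _ := integral_mono ((integrable_const 1).add (hint _ _)) (i2 x) fun _ => le_max_left _ _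

end Parameters

/-! ### The PAC-Bayes oracle inequality in expectation. -/

section PACBayes

variable {d1 d2 m n : ℕ}

/-- Exponential moment of a bounded loss satisfying Bernstein's condition. -/
lemma integral_exp_neg_mul_le {Ω : Type*} [MeasurableSpace Ω] [Finite Ω]
    [MeasurableSingletonClass Ω] (P : Measure Ω) [IsProbabilityMeasure P] {l : Ω → ℝ} {t K : ℝ}
    (ht : 0 ≤ t) (hK : 0 < K) (htK : t * K ≤ 1 / 2) (hl : ∀ z, |t * l z| ≤ 1)
    (hvar : ∫ z, l z ^ 2 ∂P ≤ K * ∫ z, l z ∂P) :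
    ∫ z, Real.exp (-(t * l z)) ∂P ≤ Real.exp (-(t / 2 * ∫ z, l z ∂P)) := by
  have hnn : 0 ≤ ∫ z, l z ∂P :=
    nonneg_of_mul_nonneg_right ((integral_nonneg fun z => sq_nonneg (l z)).trans hvar) hK
  calc ∫ z, Real.exp (-(t * l z)) ∂P ≤ ∫ z, (1 - t * l z + t ^ 2 * l z ^ 2) ∂P := by
        refine integral_mono .of_finite .of_finite fun z => ?_
        -- This is `exp u ≤ 1 + u + u ^ 2` for `|u| ≤ 1`; the variance condition with `t * K ≤ 1 /
        -- 2` then absorbs the square into half of the linear term.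
        have h := Real.abs_exp_sub_one_sub_id_le (x := -(t * l z)) (by rw [abs_neg]; exact hl z)
        have := (abs_le.mp h).2
        simp only
        nlinarith
    _ = 1 - t * ∫ z, l z ∂P + t ^ 2 * ∫ z, l z ^ 2 ∂P := by
        rw [integral_add .of_finite .of_finite, integral_sub .of_finite .of_finite,
          integral_const_mul, integral_const_mul]
        simp
    _ ≤ -(t / 2 * ∫ z, l z ∂P) + 1 := by
        have h1 : t ^ 2 * ∫ z, l z ^ 2 ∂P ≤ t ^ 2 * (K * ∫ z, l z ∂P) := by gcongr
        have h2 : t * K * (t * ∫ z, l z ∂P) ≤ 1 / 2 * (t * ∫ z, l z ∂P) := by gcongr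
        nlinarith
    _ ≤ _ := Real.add_one_le_exp _

lemma sub_hingeRisk_eq_integral (P : Measure (Obs d1 d2)) [IsProbabilityMeasure P]
    (M M' : Matrix (Fin d1) (Fin d2) ℝ) :
    ∫ z, (hinge (labelVal z.2) (M z.1.1 z.1.2) - hinge (labelVal z.2) (M' z.1.1 z.1.2)) ∂P =
      hingeRisk P M - hingeRisk P M' := by
  rw [integral_sub .of_finite .of_finite]; rfl

/-- The exponential moment behind the PAC-Bayes bound, for a fixed predictor. -/
lemma integral_exp_excess_le_one (P : Measure (Obs d1 d2)) [IsProbabilityMeasure P]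
    {M Ms : Matrix (Fin d1) (Fin d2) ℝ} {K B : ℝ} (hK : 0 < K) (hB : 2 ≤ B) (hn : n ≠ 0)
    (hM : ∀ i j y, hinge (labelVal y) (M i j) ≤ B)
    (hMs : ∀ i j y, hinge (labelVal y) (Ms i j) ≤ B)
    (hbern : sqDist P M Ms ≤ K * (hingeRisk P M - hingeRisk P Ms)) {lam : ℝ}
    (hlam : lam = n / max (2 * K) B) :
    ∫ D, Real.exp (lam / 2 * (hingeRisk P M - hingeRisk P Ms) -
      lam * (empHingeRisk D M - empHingeRisk D Ms)) ∂(Measure.pi fun _ : Fin n => P) ≤ 1 := by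
  set l : Obs d1 d2 → ℝ := fun z =>
    hinge (labelVal z.2) (M z.1.1 z.1.2) - hinge (labelVal z.2) (Ms z.1.1 z.1.2) with hl
  -- The weight of one observation. The entry `2 * K` of the maximum gives `t * K ≤ 1 / 2`, and the
  -- entry `B` gives `|t * l z| ≤ 1`.
  set t : ℝ := 1 / max (2 * K) B with ht
  have hm : 0 < max (2 * K) B := lt_of_lt_of_le (by linarith) (le_max_right _ _)
  have htpos : 0 < t := by positivity
  have hlt : lam = n * t := by rw [hlam, ht]; ring
  have hn' : (n : ℝ) ≠ 0 := by exact_mod_cast hn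
  have hE : ∫ z, l z ∂P = hingeRisk P M - hingeRisk P Ms := sub_hingeRisk_eq_integral P M Ms
  have hlB : ∀ z, |l z| ≤ B := fun z => by
    have h1 := hM z.1.1 z.1.2 z.2
    have h2 := hMs z.1.1 z.1.2 z.2
    have h3 := hinge_nonneg (labelVal z.2) (M z.1.1 z.1.2)
    have h4 := hinge_nonneg (labelVal z.2) (Ms z.1.1 z.1.2)
    rw [abs_le]; constructor <;> simp only [hl] <;> linarith
  have key := integral_exp_neg_mul_le P (l := l) htpos.le hK (K := K)
    (by
      rw [ht, div_mul_eq_mul_div, div_le_iff₀ hm]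
      linarith [le_max_left (2 * K) B])
    (fun z => by
      rw [abs_mul, abs_of_pos htpos, ht, div_mul_eq_mul_div, div_le_one hm, one_mul]
      exact (hlB z).trans (le_max_right _ _))
    (by
      rw [hE]
      -- The hinge loss is 1-Lipschitz, so the second moment of the loss difference is at most the
      -- squared distance of the predictors.
      refine le_trans ?_ hbern
      refine integral_mono .of_finite .of_finite fun z => ?_
      exact sq_le_sq.mpr (abs_hinge_sub_le _ _ _))
  have hexp : ∀ D : Fin n → Obs d1 d2, Real.exp (lam / 2 * (hingeRisk P M - hingeRisk P Ms) -
      lam * (empHingeRisk D M - empHingeRisk D Ms)) =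
      Real.exp (t / 2 * ∫ z, l z ∂P) ^ n * ∏ k, Real.exp (-(t * l (D k))) := fun D => by
    rw [← Real.exp_nat_mul, ← Real.exp_sum, ← Real.exp_add, hE, hlt]
    congr 1
    have : empHingeRisk D M - empHingeRisk D Ms = (1 / n) * ∑ k, l (D k) := by
      simp only [empHingeRisk, hl, Finset.sum_sub_distrib]; ring
    rw [this, Finset.sum_neg_distrib, ← Finset.mul_sum]
    field_simp
    ring
  simp only [hexp]
  rw [integral_const_mul,
    integral_fintype_prod_eq_prod (fun _ : Fin n => fun z => Real.exp (-(t * l z)))]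
  simp only [Finset.prod_const, Finset.card_univ, Fintype.card_fin]
  rw [← mul_pow]
  refine pow_le_one₀ (mul_nonneg (Real.exp_pos _).le
    (integral_nonneg fun _ => (Real.exp_pos _).le)) ?_
  calc _ ≤ Real.exp (t / 2 * ∫ z, l z ∂P) * Real.exp (-(t / 2 * ∫ z, l z ∂P)) := by gcongr
    _ = 1 := by rw [← Real.exp_add]; simp

lemma hinge_le_of_sign {B s : ℝ} (hB : 2 ≤ B) (hs : s = 1 ∨ s = -1) (y : Bool) :
    hinge (labelVal y) s ≤ B := by
  refine max_le ?_ (by linarith)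
  rcases labelVal_eq y with hy | hy <;> rcases hs with hs | hs <;> rw [hy, hs] <;> linarith

lemma empHingeRisk_nonneg (D : Fin n → Obs d1 d2) (M : Matrix (Fin d1) (Fin d2) ℝ) :
    0 ≤ empHingeRisk D M :=
  mul_nonneg (by positivity) (Finset.sum_nonneg fun _ _ => hinge_nonneg _ _)

lemma empHingeRisk_le {B : ℝ} (hB : 0 ≤ B) (D : Fin n → Obs d1 d2)
    {M : Matrix (Fin d1) (Fin d2) ℝ} (hM : ∀ i j y, hinge (labelVal y) (M i j) ≤ B) :
    empHingeRisk D M ≤ B := by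
  rcases Nat.eq_zero_or_pos n with rfl | hn
  · simpa [empHingeRisk] using hB
  · have : (0 : ℝ) < n := by exact_mod_cast hn
    calc empHingeRisk D M ≤ 1 / n * ∑ _k : Fin n, B := by
          unfold empHingeRisk; gcongr; exact hM _ _ _
      _ = B := by simp; field_simp

lemma empHingeRisk_le_add {δ : ℝ} (hδ : 0 ≤ δ) (D : Fin n → Obs d1 d2)
    {M M' : Matrix (Fin d1) (Fin d2) ℝ} (h : ∀ i j, |M i j - M' i j| ≤ δ) :
    empHingeRisk D M ≤ empHingeRisk D M' + δ := by
  rcases Nat.eq_zero_or_pos n with rfl | hn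
  · simpa [empHingeRisk] using hδ
  · have : (0 : ℝ) < n := by exact_mod_cast hn
    calc empHingeRisk D M
        ≤ 1 / n * ∑ k, (hinge (labelVal (D k).2) (M' (D k).1.1 (D k).1.2) + δ) := by
          unfold empHingeRisk
          gcongr with k
          have h1 := abs_hinge_sub_le (D k).2 (M (D k).1.1 (D k).1.2) (M' (D k).1.1 (D k).1.2)
          linarith [(abs_le.mp (h1.trans (h _ _))).2]
      _ = empHingeRisk D M' + δ := by
          simp [empHingeRisk, Finset.sum_add_distrib]; field_simp

/-- PAC-Bayes oracle inequality for measures that are at least as close to the Gibbs posterior as a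
measure `ρ'` concentrated near the Bayes matrix. -/
theorem integral_excess_le_of_klDiv_le (P : Measure (Obs d1 d2)) [IsProbabilityMeasure P]
    {Ms : Matrix (Fin d1) (Fin d2) ℝ} {K B c δ lam : ℝ} (hK : 0 < K) (hB : 2 ≤ B) (hn : n ≠ 0)
    (hMs : ∀ i j, Ms i j = 1 ∨ Ms i j = -1)
    (hbern : ∀ θ ∈ paramSet d1 d2 m B, sqDist P (toMatrix θ) Ms ≤
      K * (hingeRisk P (toMatrix θ) - hingeRisk P Ms))
    (hlam : lam = n / max (2 * K) B)
    (π : Measure (Params d1 d2 m)) [IsProbabilityMeasure π] (hπ : ∀ᵐ θ ∂π, θ ∈ paramSet d1 d2 m B)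
    (ρ' : Measure (Params d1 d2 m)) [IsProbabilityMeasure ρ']
    (hρ' : ρ' ≤ ENNReal.ofReal (Real.exp c) • π) (hδ : 0 ≤ δ)
    (hρ'δ : ∀ᵐ θ ∂ρ', ∀ i j, |toMatrix θ i j - Ms i j| ≤ δ)
    (ρ : (Fin n → Obs d1 d2) → Measure (Params d1 d2 m)) [∀ D, IsProbabilityMeasure (ρ D)]
    (hkl : ∀ D, InformationTheory.klDiv (ρ D) (gibbs π lam D) ≤
      InformationTheory.klDiv ρ' (gibbs π lam D)) :
    (∀ D, ρ D ≪ π) ∧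
      ∫ D, (∫ θ, (hingeRisk P (toMatrix θ) - hingeRisk P Ms) ∂(ρ D))
        ∂(Measure.pi fun _ : Fin n => P) ≤ 2 * (c / lam + δ) := by
  have hm : 0 < max (2 * K) B := lt_of_lt_of_le (by linarith) (le_max_right _ _)
  have hlpos : 0 < lam := by
    rw [hlam]; exact div_pos (by exact_mod_cast Nat.pos_of_ne_zero hn) hm
  have hMsB : ∀ i j y, hinge (labelVal y) (Ms i j) ≤ B := fun i j => hinge_le_of_sign hB (hMs i j)
  have hRs : hingeRisk P Ms ≤ B := by
    calc hingeRisk P Ms ≤ ∫ _, B ∂P := integral_mono .of_finite .of_finite fun z => hMsB _ _ _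
      _ = B := by simp
  have hgb : ∀ᵐ θ ∂π, |lam / 2 * (hingeRisk P (toMatrix θ) - hingeRisk P Ms)| ≤ lam / 2 * B := by
    filter_upwards [hπ] with θ hθ
    rw [abs_mul, abs_of_pos (by positivity)]
    gcongr
    rw [abs_le]
    constructor <;> linarith [hingeRisk_le_of_mem_paramSet P hθ, hingeRisk_nonneg P Ms,
      hingeRisk_nonneg P (toMatrix θ)]
  have hfb : ∀ D : Fin n → Obs d1 d2, ∀ᵐ θ ∂π, |lam * empHingeRisk D (toMatrix θ)| ≤ lam * B := fun D => by
    filter_upwards [hπ] with θ hθ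
    rw [abs_mul, abs_of_pos hlpos, abs_of_nonneg (empHingeRisk_nonneg _ _)]
    gcongr
    exact empHingeRisk_le (by linarith) D hθ
  have main := fun D => integral_le_of_klDiv_tilted_le (π := π) (ρ := ρ D) (ρ' := ρ')
    (f := fun θ => lam * empHingeRisk D (toMatrix θ))
    (g := fun θ => lam / 2 * (hingeRisk P (toMatrix θ) - hingeRisk P Ms))
    (b := lam * (empHingeRisk D Ms + δ)) (c := c) (by fun_prop) (by fun_prop) (hfb D) hgb hρ'
    (by
      filter_upwards [hρ'δ] with θ hθ
      gcongr
      exact empHingeRisk_le_add hδ D hθ)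
    (by simpa only [gibbs, neg_mul] using hkl D)
  refine ⟨fun D => (main D).1, ?_⟩
  set w : (Fin n → Obs d1 d2) → Params d1 d2 m → ℝ := fun D θ =>
    Real.exp (lam / 2 * (hingeRisk P (toMatrix θ) - hingeRisk P Ms) -
      lam * (empHingeRisk D (toMatrix θ) - empHingeRisk D Ms)) with hw
  have hwb : ∀ D, ∀ᵐ θ ∂π, ‖w D θ‖ ≤ Real.exp (lam / 2 * B + lam * B) := fun D => by
    filter_upwards [hgb, hfb D] with θ h1 h2
    rw [Real.norm_eq_abs, hw, Real.abs_exp]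
    refine Real.exp_le_exp.mpr ?_
    have h3 := empHingeRisk_le (by linarith) D hMsB
    have h4 : lam * empHingeRisk D Ms ≤ lam * B := by gcongr
    have h5 := mul_nonneg hlpos.le (empHingeRisk_nonneg D (toMatrix θ))
    linarith [le_abs_self (lam / 2 * (hingeRisk P (toMatrix θ) - hingeRisk P Ms))]
  have hwm : ∀ D, Measurable (w D) := fun D => by simp only [hw]; fun_prop
  have hwi : ∀ D, Integrable (w D) π := fun D =>
    Integrable.of_bound (hwm D).aestronglyMeasurable _ (hwb D)
  have step : ∀ D, ∫ θ, (hingeRisk P (toMatrix θ) - hingeRisk P Ms) ∂(ρ D) ≤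
      2 / lam * (c + lam * δ - 1 + ∫ θ, w D θ ∂π) := fun D => by
    have h1 := (main D).2
    have h2 : ∫ θ, w D θ ∂π = Real.exp (lam * empHingeRisk D Ms) * ∫ θ, Real.exp
        (lam / 2 * (hingeRisk P (toMatrix θ) - hingeRisk P Ms) -
          lam * empHingeRisk D (toMatrix θ)) ∂π := by
      rw [← integral_const_mul]
      refine integral_congr_ae (.of_forall fun θ => ?_)
      simp only [hw]
      rw [← Real.exp_add]
      congr 1; ring
    have hpos : 0 < ∫ θ, w D θ ∂π := integral_exp_pos (hwi D)
    have h3 : Real.log (∫ θ, w D θ ∂π) = lam * empHingeRisk D Ms + Real.log (∫ θ, Real.exp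
        (lam / 2 * (hingeRisk P (toMatrix θ) - hingeRisk P Ms) -
          lam * empHingeRisk D (toMatrix θ)) ∂π) := by
      rw [h2, Real.log_mul (Real.exp_pos _).ne', Real.log_exp]
      intro h0; rw [h2, h0, mul_zero] at hpos; exact lt_irrefl _ hpos
    -- Bounding the logarithm by an affine function leaves a quantity that can be averaged over
    -- samples by Fubini, without Jensen's inequality.
    have h4 := Real.log_le_sub_one_of_pos hpos
    rw [integral_const_mul] at h1
    rw [div_mul_eq_mul_div, le_div_iff₀ hlpos]
    nlinarith
  -- For fixed `θ` in the parameter set the sample average of `w` is at most 1, and `π` does not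
  -- depend on the sample. The sample space is finite, so no measurability of `D ↦ ρ D` is involved.
  have hswap : ∫ D, ∫ θ, w D θ ∂π ∂(Measure.pi fun _ : Fin n => P) ≤ 1 := by
    have hprod : Integrable (Function.uncurry w) ((Measure.pi fun _ : Fin n => P).prod π) := by
      have hmeas : Measurable (Function.uncurry w) :=
        measurable_from_prod_countable_right fun D => hwm D
      refine Integrable.of_bound hmeas.aestronglyMeasurable (Real.exp (lam / 2 * B + lam * B)) ?_
      refine (Measure.ae_prod_iff_ae_ae
        (measurableSet_le hmeas.norm measurable_const)).mpr (.of_forall fun D => hwb D)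
    rw [integral_integral_swap hprod]
    calc _ ≤ ∫ _, (1 : ℝ) ∂π := by
          refine integral_mono_ae hprod.integral_prod_right (integrable_const _) ?_
          filter_upwards [hπ] with θ hθ
          exact integral_exp_excess_le_one P hK hB hn hθ hMsB (hbern θ hθ) hlam
      _ = 1 := by simp
  calc _ ≤ ∫ D, 2 / lam * (c + lam * δ - 1 + ∫ θ, w D θ ∂π) ∂(Measure.pi fun _ : Fin n => P) :=
        integral_mono .of_finite .of_finite step
    _ = 2 / lam * (c + lam * δ - 1 + ∫ D, ∫ θ, w D θ ∂π ∂(Measure.pi fun _ : Fin n => P)) := by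
        rw [integral_const_mul, integral_add .of_finite .of_finite]
        simp
    _ ≤ 2 / lam * (c + lam * δ) :=
        mul_le_mul_of_nonneg_left (by linarith) (by positivity)
    _ = _ := by field_simp

end PACBayes

/-! ### Densities on finite products. -/

section Product

lemma lintegral_pi_prod {n : ℕ} {E : Type*} [MeasurableSpace E]
    {μ : Fin n → Measure E} [∀ i, SigmaFinite (μ i)]
    {f : Fin n → E → ℝ≥0∞} (hf : ∀ i, Measurable (f i)) :
    ∫⁻ x, ∏ i, f i (x i) ∂(Measure.pi μ) = ∏ i, ∫⁻ x, f i x ∂(μ i) := by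
  induction n with
  | zero => simp
  | succ n ih =>
    have hm : Measurable fun x : Fin n → E => ∏ i, f (Fin.succ i) (x i) :=
      Finset.measurable_fun_prod _ fun i _ => (hf i.succ).comp (measurable_pi_apply i)
    calc ∫⁻ x, ∏ i, f i (x i) ∂(Measure.pi μ)
        = ∫⁻ x : E × (Fin n → E), f 0 x.1 * ∏ i : Fin n, f (Fin.succ i) (x.2 i)
            ∂((μ 0).prod (Measure.pi fun i => μ i.succ)) := by
          refine Eq.trans (lintegral_congr fun x => ?_)
            ((measurePreserving_piFinSuccAbove μ 0).lintegral_comp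
              (((hf 0).comp measurable_fst).mul (hm.comp measurable_snd)))
          exact Fin.prod_univ_succ _
      _ = _ := by
          rw [lintegral_prod_mul (hf 0).aemeasurable hm.aemeasurable, ih fun i => hf i.succ,
            Fin.prod_univ_succ]

lemma pi_withDensity {n : ℕ} {E : Type*} [MeasurableSpace E]
    {μ : Fin n → Measure E} [∀ i, SigmaFinite (μ i)] {f : Fin n → E → ℝ≥0∞} (hf : ∀ i, Measurable (f i))
    [∀ i, SigmaFinite ((μ i).withDensity (f i))] :
    Measure.pi (fun i => (μ i).withDensity (f i)) =
      (Measure.pi μ).withDensity fun x => ∏ i, f i (x i) := by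
  refine Measure.pi_eq fun s hs => ?_
  rw [withDensity_apply _ (MeasurableSet.univ_pi hs),
    ← lintegral_indicator (MeasurableSet.univ_pi hs)]
  have : (Set.univ.pi s).indicator (fun x => ∏ i, f i (x i)) =
      fun x => ∏ i, (s i).indicator (f i) (x i) := by
    classical
    ext x
    by_cases h : x ∈ Set.univ.pi s
    · rw [Set.indicator_of_mem h]
      exact Finset.prod_congr rfl fun i _ => (Set.indicator_of_mem (h i trivial) _).symm
    · rw [Set.indicator_of_notMem h]
      simp only [Set.mem_univ_pi, not_forall] at h
      obtain ⟨i, hi⟩ := h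
      exact (Finset.prod_eq_zero (Finset.mem_univ i) (Set.indicator_of_notMem hi _)).symm
  rw [this, lintegral_pi_prod fun i => (hf i).indicator (hs i)]
  refine Finset.prod_congr rfl fun i _ => ?_
  rw [lintegral_indicator (hs i), withDensity_apply _ (hs i)]

end Product

/-! ### Total mass of the hierarchical law. -/

section HierarchicalPrior

lemma measurable_invGammaPDF (a b : ℝ) : Measurable (invGammaPDF a b) := by
  unfold invGammaPDF
  refine ENNReal.measurable_ofReal.comp (Measurable.ite measurableSet_Ioi ?_ measurable_const)
  fun_prop

lemma measurable_variancePDF (fam : VarianceFamily) (a b : ℝ) :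
    Measurable (variancePDF fam a b) := by
  cases fam
  · exact ENNReal.measurable_ofReal.comp (measurable_gammaPDFReal a b)
  · exact measurable_invGammaPDF a b

/-- The substitution `x ↦ x⁻¹` turns this density on the half-line into `gammaPDF a b`. -/
lemma lintegral_invGammaPDF_le {a b : ℝ} (ha : 0 < a) (hb : 0 < b) :
    ∫⁻ x, invGammaPDF a b x ≤ 1 := by
  have himg : (fun x : ℝ => x⁻¹) '' Set.Ioi 0 = Set.Ioi 0 := by
    ext x; simp
  have hsub := lintegral_image_eq_lintegral_abs_deriv_mul (s := Set.Ioi (0 : ℝ))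
    measurableSet_Ioi (f := fun x => x⁻¹) (f' := fun x => -(x ^ 2)⁻¹)
    (fun x hx => (hasDerivAt_inv (ne_of_gt hx)).hasDerivWithinAt)
    inv_injective.injOn (gammaPDF a b)
  rw [himg] at hsub
  calc ∫⁻ x, invGammaPDF a b x = ∫⁻ x in Set.Ioi 0, invGammaPDF a b x := by
        rw [← lintegral_indicator measurableSet_Ioi]
        refine lintegral_congr fun x => ?_
        by_cases hx : 0 < x
        · rw [Set.indicator_of_mem (by exact hx)]
        · rw [Set.indicator_of_notMem (by exact hx)]; simp [invGammaPDF, hx]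
    _ = ∫⁻ x in Set.Ioi 0, gammaPDF a b x := by
        rw [hsub]
        refine setLIntegral_congr_fun measurableSet_Ioi fun x hx => ?_
        have hx0 : 0 < x := hx
        simp only [invGammaPDF, if_pos hx0]
        rw [gammaPDF_of_nonneg (inv_pos.mpr hx0).le, ← ENNReal.ofReal_mul (abs_nonneg _)]
        congr 1
        rw [abs_neg, abs_of_pos (by positivity), Real.inv_rpow hx0.le, ← Real.rpow_neg hx0.le,
          ← Real.rpow_natCast, ← Real.rpow_neg hx0.le, ← div_eq_mul_inv]
        have : x ^ (-a - 1) = x ^ (-((2 : ℕ) : ℝ)) * x ^ (-(a - 1)) := by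
          rw [← Real.rpow_add hx0]; congr 1; push_cast; ring
        rw [this]; ring
    _ ≤ ∫⁻ x, gammaPDF a b x := setLIntegral_le_lintegral _ _
    _ = 1 := lintegral_gammaPDF_eq_one ha hb

lemma lintegral_variancePDF_le (fam : VarianceFamily) {a b : ℝ} (ha : 0 < a) (hb : 0 < b) :
    ∫⁻ x, variancePDF fam a b x ≤ 1 := by
  cases fam
  · exact (lintegral_gammaPDF_eq_one ha hb).le
  · exact lintegral_invGammaPDF_le ha hb

/-- An inequality because `gaussianPDF` is identically zero at variance 0, the value `toNNReal`
assigns to nonpositive variance coordinates. -/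
lemma lintegral_gaussianPDF_le (μ : ℝ) (v : NNReal) : ∫⁻ x, gaussianPDF μ v x ≤ 1 := by
  by_cases hv : v = 0
  · simp [hv]
  · exact (lintegral_gaussianPDF_eq_one μ hv).le

/-- The density of an array of independent centered Gaussian variables with column variances `v` has
mass at most one. -/
lemma lintegral_gaussian_array_le (d m : ℕ) (v : Fin m → NNReal) :
    ∫⁻ L : Fin d → Fin m → ℝ, ∏ k, ∏ i, gaussianPDF 0 (v k) (L i k) ≤ 1 := by
  calc ∫⁻ L : Fin d → Fin m → ℝ, ∏ k, ∏ i, gaussianPDF 0 (v k) (L i k)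
      = ∫⁻ L : Fin d → Fin m → ℝ, ∏ i, ∏ k, gaussianPDF 0 (v k) (L i k) :=
        lintegral_congr fun L => Finset.prod_comm
    _ = ∏ _i : Fin d, ∏ k, ∫⁻ x, gaussianPDF 0 (v k) x := by
        rw [volume_pi, lintegral_pi_prod (E := Fin m → ℝ)
          (f := fun _ l => ∏ k, gaussianPDF 0 (v k) (l k))]
        · refine Finset.prod_congr rfl fun i _ => ?_
          rw [volume_pi, lintegral_pi_prod (E := ℝ)
            (f := fun k => gaussianPDF 0 (v k)) fun k => measurable_gaussianPDF _ _]
        · exact fun _ => Finset.measurable_fun_prod _ fun k _ =>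
            (measurable_gaussianPDF _ _).comp (measurable_pi_apply k)
    _ ≤ 1 := Finset.prod_le_one' fun i _ => Finset.prod_le_one' fun k _ =>
        lintegral_gaussianPDF_le _ _

variable (d1 d2 m : ℕ)

lemma measurable_gaussianPDF_toNNReal {α : Type*} [MeasurableSpace α] {v x : α → ℝ}
    (hv : Measurable v) (hx : Measurable x) :
    Measurable fun t => gaussianPDF 0 (v t).toNNReal (x t) :=
  measurable_uncurry_gaussianPDF.comp
    (measurable_const.prodMk (hv.real_toNNReal.prodMk hx))

/-- Integrate out `L`, then `R`, then `γ`. Mass at most 1 is all that is needed: conditioning on the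
parameter set divides by its mass and so can only enlarge the measure there. -/
lemma hierarchicalPrior_univ_le (fam : VarianceFamily) {a b : ℝ} (ha : 0 < a) (hb : 0 < b) :
    hierarchicalPrior d1 d2 m fam a b Set.univ ≤ 1 := by
  have mf := measurable_variancePDF fam a b
  have mR : Measurable fun θ : (Fin d2 → Fin m → ℝ) × (Fin m → ℝ) =>
      ∏ k, (variancePDF fam a b (θ.2 k) *
        ∏ j, gaussianPDF 0 (θ.2 k).toNNReal (θ.1 j k)) :=
    Finset.measurable_fun_prod _ fun k _ => (mf.comp (by fun_prop)).mul
      (Finset.measurable_fun_prod _ fun j _ =>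
        measurable_gaussianPDF_toNNReal (by fun_prop) (by fun_prop))
  have mL : Measurable fun θ : Params d1 d2 m =>
      ∏ k, (variancePDF fam a b (θ.2.2 k) *
        (∏ i, gaussianPDF 0 (θ.2.2 k).toNNReal (θ.1 i k)) *
        (∏ j, gaussianPDF 0 (θ.2.2 k).toNNReal (θ.2.1 j k))) :=
    Finset.measurable_fun_prod _ fun k _ => ((mf.comp (by fun_prop)).mul
      (Finset.measurable_fun_prod _ fun j _ =>
        measurable_gaussianPDF_toNNReal (by fun_prop) (by fun_prop))).mul
      (Finset.measurable_fun_prod _ fun j _ =>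
        measurable_gaussianPDF_toNNReal (by fun_prop) (by fun_prop))
  have mA : ∀ (d : ℕ) (v : Fin m → NNReal), Measurable fun L : Fin d → Fin m → ℝ =>
      ∏ k, ∏ i, gaussianPDF 0 (v k) (L i k) := fun d v =>
    Finset.measurable_fun_prod _ fun k _ => Finset.measurable_fun_prod _ fun i _ =>
      (measurable_gaussianPDF _ _).comp (by fun_prop)
  rw [hierarchicalPrior, withDensity_apply _ MeasurableSet.univ, setLIntegral_univ,
    Measure.volume_eq_prod, lintegral_prod_symm _ mL.aemeasurable]
  calc _ ≤ ∫⁻ θ : (Fin d2 → Fin m → ℝ) × (Fin m → ℝ), ∏ k, (variancePDF fam a b (θ.2 k) *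
        ∏ j, gaussianPDF 0 (θ.2 k).toNNReal (θ.1 j k)) := by
        refine lintegral_mono fun θ => ?_
        calc _ = ∫⁻ L : Fin d1 → Fin m → ℝ, (∏ k, (variancePDF fam a b (θ.2 k) *
              ∏ j, gaussianPDF 0 (θ.2 k).toNNReal (θ.1 j k))) *
              ∏ k, ∏ i, gaussianPDF 0 (θ.2 k).toNNReal (L i k) := by
              refine lintegral_congr fun L => ?_
              rw [← Finset.prod_mul_distrib]
              exact Finset.prod_congr rfl fun k _ => by ring
          _ ≤ _ := by
              rw [lintegral_const_mul _ (mA _ _)]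
              exact mul_le_of_le_one_right' (lintegral_gaussian_array_le _ _ _)
    _ ≤ ∫⁻ γ : Fin m → ℝ, ∏ k, variancePDF fam a b (γ k) := by
        rw [Measure.volume_eq_prod, lintegral_prod_symm _ mR.aemeasurable]
        refine lintegral_mono fun γ => ?_
        calc _ = ∫⁻ R : Fin d2 → Fin m → ℝ, (∏ k, variancePDF fam a b (γ k)) *
              ∏ k, ∏ j, gaussianPDF 0 (γ k).toNNReal (R j k) := by
              refine lintegral_congr fun R => ?_
              rw [← Finset.prod_mul_distrib]
          _ ≤ _ := by
              rw [lintegral_const_mul _ (mA _ _)]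
              exact mul_le_of_le_one_right' (lintegral_gaussian_array_le _ _ _)
    _ ≤ 1 := by
        rw [volume_pi, lintegral_pi_prod (E := ℝ)
          (f := fun _ => variancePDF fam a b) fun _ => mf]
        exact Finset.prod_le_one' fun k _ => lintegral_variancePDF_le fam ha hb

end HierarchicalPrior

/-! ### Factorized laws dominated by the prior. -/

section Factorized

variable {d1 d2 m : ℕ}

/-- The density of a fully factorized law of the parameters, with one-dimensional densities
`p`, `q`, `g`. -/
noncomputable def productDensity (p : Fin d1 → Fin m → ℝ → ℝ≥0∞) (q : Fin d2 → Fin m → ℝ → ℝ≥0∞)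
    (g : Fin m → ℝ → ℝ≥0∞) (θ : Params d1 d2 m) : ℝ≥0∞ :=
  ∏ k, (g k (θ.2.2 k) * (∏ i, p i k (θ.1 i k)) * (∏ j, q j k (θ.2.1 j k)))

lemma isProbabilityMeasure_withDensity_of_lintegral {α : Type*} [MeasurableSpace α]
    {μ : Measure α} {f : α → ℝ≥0∞} (h : ∫⁻ x, f x ∂μ = 1) :
    IsProbabilityMeasure (μ.withDensity f) :=
  ⟨by rw [withDensity_apply _ MeasurableSet.univ, setLIntegral_univ, h]⟩

variable {p : Fin d1 → Fin m → ℝ → ℝ≥0∞} {q : Fin d2 → Fin m → ℝ → ℝ≥0∞}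
  {g : Fin m → ℝ → ℝ≥0∞}

lemma measurable_productDensity (hp : ∀ i k, Measurable (p i k)) (hq : ∀ j k, Measurable (q j k))
    (hg : ∀ k, Measurable (g k)) : Measurable (productDensity p q g) :=
  Finset.measurable_fun_prod _ fun k _ => (((hg k).comp (by fun_prop)).mul
    (Finset.measurable_fun_prod _ fun i _ => (hp i k).comp (by fun_prop))).mul
    (Finset.measurable_fun_prod _ fun j _ => (hq j k).comp (by fun_prop))

lemma pi_pi_withDensity {d : ℕ} {p : Fin d → Fin m → ℝ → ℝ≥0∞}
    (hp : ∀ i k, Measurable (p i k)) (hp1 : ∀ i k, ∫⁻ x, p i k x = 1) :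
    (Measure.pi fun i => Measure.pi fun k => (volume : Measure ℝ).withDensity (p i k)) =
      (volume : Measure (Fin d → Fin m → ℝ)).withDensity fun L => ∏ k, ∏ i, p i k (L i k) := by
  have i1 : ∀ i k, IsProbabilityMeasure ((volume : Measure ℝ).withDensity (p i k)) := fun i k =>
    isProbabilityMeasure_withDensity_of_lintegral (hp1 i k)
  have e : ∀ i, (Measure.pi fun k => (volume : Measure ℝ).withDensity (p i k)) =
      (volume : Measure (Fin m → ℝ)).withDensity fun l => ∏ k, p i k (l k) := fun i => by
    rw [volume_pi]; exact pi_withDensity (hp i)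
  have i2 : ∀ i, IsProbabilityMeasure ((volume : Measure (Fin m → ℝ)).withDensity
      fun l => ∏ k, p i k (l k)) := fun i => by rw [← e]; infer_instance
  simp only [e]
  have hm : ∀ i, Measurable fun l : Fin m → ℝ => ∏ k, p i k (l k) := fun i =>
    Finset.measurable_fun_prod _ fun k _ => (hp i k).comp (measurable_pi_apply k)
  rw [pi_withDensity hm, ← volume_pi]
  congr 1
  ext L
  exact Finset.prod_comm

/-- The link between the two views of the competitor: its density is what is compared with the
prior, its product form is what puts it in `fullyFactorized`. -/
lemma withDensity_productDensity_eq (hp : ∀ i k, Measurable (p i k))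
    (hq : ∀ j k, Measurable (q j k)) (hg : ∀ k, Measurable (g k))
    (hp1 : ∀ i k, ∫⁻ x, p i k x = 1) (hq1 : ∀ j k, ∫⁻ x, q j k x = 1)
    (hg1 : ∀ k, ∫⁻ x, g k x = 1) :
    (volume : Measure (Params d1 d2 m)).withDensity (productDensity p q g) =
      (Measure.pi fun i => Measure.pi fun k => (volume : Measure ℝ).withDensity (p i k)).prod
        ((Measure.pi fun j => Measure.pi fun k => (volume : Measure ℝ).withDensity (q j k)).prod
          (Measure.pi fun k => (volume : Measure ℝ).withDensity (g k))) := by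
  have i1 : ∀ k, IsProbabilityMeasure ((volume : Measure ℝ).withDensity (g k)) := fun k =>
    isProbabilityMeasure_withDensity_of_lintegral (hg1 k)
  have mp : ∀ {d : ℕ} {p : Fin d → Fin m → ℝ → ℝ≥0∞}, (∀ i k, Measurable (p i k)) →
      Measurable fun L : Fin d → Fin m → ℝ => ∏ k, ∏ i, p i k (L i k) := fun hp =>
    Finset.measurable_fun_prod _ fun k _ => Finset.measurable_fun_prod _ fun i _ =>
      (hp i k).comp (by fun_prop)
  have mg : Measurable fun γ : Fin m → ℝ => ∏ k, g k (γ k) :=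
    Finset.measurable_fun_prod _ fun k _ => (hg k).comp (by fun_prop)
  have mqg : Measurable fun z : (Fin d2 → Fin m → ℝ) × (Fin m → ℝ) =>
      (∏ k, ∏ j, q j k (z.1 j k)) * ∏ k, g k (z.2 k) :=
    ((mp hq).comp measurable_fst).mul (mg.comp measurable_snd)
  rw [pi_pi_withDensity hp hp1, pi_pi_withDensity hq hq1, pi_withDensity hg, ← volume_pi,
    prod_withDensity (mp hq) mg, prod_withDensity (mp hp) mqg, ← Measure.volume_eq_prod,
    ← Measure.volume_eq_prod]
  congr 1
  ext θ
  rw [productDensity, Finset.prod_mul_distrib, Finset.prod_mul_distrib]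
  ring

/-- A factorized law, carried by `Θ`, whose density is columnwise dominated by the density of the
hierarchical model is dominated by the prior. -/
lemma exists_factorized_le_prior (fam : VarianceFamily) {a b B : ℝ} (ha : 0 < a) (hb : 0 < b)
    (hp : ∀ i k, Measurable (p i k)) (hq : ∀ j k, Measurable (q j k)) (hg : ∀ k, Measurable (g k))
    (hp1 : ∀ i k, ∫⁻ x, p i k x = 1) (hq1 : ∀ j k, ∫⁻ x, q j k x = 1)
    (hg1 : ∀ k, ∫⁻ x, g k x = 1) {cost : Fin m → ℝ}
    (hcol : ∀ k x (l : Fin d1 → ℝ) (r : Fin d2 → ℝ),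
      g k x * (∏ i, p i k (l i)) * (∏ j, q j k (r j)) ≤ ENNReal.ofReal (Real.exp (cost k)) *
        (variancePDF fam a b x * (∏ i, gaussianPDF 0 x.toNNReal (l i)) *
          (∏ j, gaussianPDF 0 x.toNNReal (r j))))
    (hsupp : ∀ θ : Params d1 d2 m, (∀ i k, p i k (θ.1 i k) ≠ 0) → (∀ j k, q j k (θ.2.1 j k) ≠ 0) →
      θ ∈ paramSet d1 d2 m B) :
    IsProbabilityMeasure (prior d1 d2 m fam a b B) ∧ ∃ ρ ∈ fullyFactorized d1 d2 m,
      IsProbabilityMeasure ρ ∧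
      ρ ≤ ENNReal.ofReal (Real.exp (∑ k, cost k)) • prior d1 d2 m fam a b B ∧
      ∀ᵐ θ ∂ρ, (∀ i k, p i k (θ.1 i k) ≠ 0) ∧ (∀ j k, q j k (θ.2.1 j k) ≠ 0) := by
  have ip : ∀ i k, IsProbabilityMeasure ((volume : Measure ℝ).withDensity (p i k)) := fun i k =>
    isProbabilityMeasure_withDensity_of_lintegral (hp1 i k)
  have iq : ∀ i k, IsProbabilityMeasure ((volume : Measure ℝ).withDensity (q i k)) := fun i k =>
    isProbabilityMeasure_withDensity_of_lintegral (hq1 i k)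
  have ig : ∀ k, IsProbabilityMeasure ((volume : Measure ℝ).withDensity (g k)) := fun k =>
    isProbabilityMeasure_withDensity_of_lintegral (hg1 k)
  set ρ := (volume : Measure (Params d1 d2 m)).withDensity (productDensity p q g) with hρ
  set c := ENNReal.ofReal (Real.exp (∑ k, cost k)) with hc
  have hρeq := withDensity_productDensity_eq hp hq hg hp1 hq1 hg1
  have hρprob : IsProbabilityMeasure ρ := by rw [hρ, hρeq]; infer_instance
  have hae : ∀ᵐ θ ∂ρ, (∀ i k, p i k (θ.1 i k) ≠ 0) ∧ (∀ j k, q j k (θ.2.1 j k) ≠ 0) := by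
    rw [hρ, ae_withDensity_iff (measurable_productDensity hp hq hg)]
    refine .of_forall fun θ hθ => ?_
    simp only [productDensity, Finset.prod_ne_zero_iff, mul_ne_zero_iff, Finset.mem_univ,
      true_imp_iff] at hθ
    exact ⟨fun i k => (hθ k).1.2 i, fun j k => (hθ k).2 j⟩
  have hΘ : ∀ᵐ θ ∂ρ, θ ∈ paramSet d1 d2 m B := by
    filter_upwards [hae] with θ hθ using hsupp θ hθ.1 hθ.2
  have hle : ρ ≤ c • hierarchicalPrior d1 d2 m fam a b := by
    rw [hierarchicalPrior, ← withDensity_smul' _ _ ENNReal.ofReal_ne_top]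
    refine withDensity_mono (.of_forall fun θ => ?_)
    rw [Pi.smul_apply, smul_eq_mul, Real.exp_sum,
      ENNReal.ofReal_prod_of_nonneg fun k _ => (Real.exp_pos _).le, ← Finset.prod_mul_distrib]
    exact Finset.prod_le_prod' fun k _ => hcol k (θ.2.2 k) (fun i => θ.1 i k) fun j => θ.2.1 j k
  set H := hierarchicalPrior d1 d2 m fam a b with hH
  have hΘm := measurableSet_paramSet (d1 := d1) (d2 := d2) (m := m) B
  have hρΘ : ∀ s, ρ s ≤ c * H (paramSet d1 d2 m B ∩ s) := fun s => by
    calc ρ s = ρ (paramSet d1 d2 m B ∩ s) := by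
          refine measure_congr ?_
          filter_upwards [hΘ] with θ hθ
          simp only [eq_iff_iff]
          exact ⟨fun h => ⟨hθ, h⟩, fun h => h.2⟩
      _ ≤ _ := by simpa using hle (paramSet d1 d2 m B ∩ s)
  have hHle : H (paramSet d1 d2 m B) ≤ 1 :=
    (measure_mono (Set.subset_univ _)).trans (hierarchicalPrior_univ_le d1 d2 m fam ha hb)
  -- A probability measure carried by the parameter set is dominated by a multiple of `H`, so `H`
  -- charges that set and conditioning is meaningful.
  have hHne : H (paramSet d1 d2 m B) ≠ 0 := fun h0 => by
    have := hρΘ Set.univ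
    rw [Set.inter_univ, h0, mul_zero, measure_univ] at this
    simp at this
  have hHtop : H (paramSet d1 d2 m B) ≠ ∞ := ne_top_of_le_ne_top ENNReal.one_ne_top hHle
  refine ⟨cond_isProbabilityMeasure_of_finite hHne hHtop, ρ,
    ⟨_, _, _, ip, iq, ig, hρeq⟩, hρprob, fun s => ?_, hae⟩
  refine (hρΘ s).trans ?_
  rw [Measure.smul_apply, smul_eq_mul, prior, cond_apply hΘm]
  gcongr
  exact le_mul_of_one_le_left' (ENNReal.one_le_inv.mpr hHle)

/-- The cost of one column: `c0` for its variance and `c1` for each of its `d1 + d2` entries. Where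
`g` vanishes the left side is zero, so the Gaussian comparisons are required only for variances in
the support of `g`. -/
lemma prod_column_le {fam : VarianceFamily} {a b c0 c1 x : ℝ} {g : ℝ → ℝ≥0∞}
    {p : Fin d1 → ℝ → ℝ≥0∞} {q : Fin d2 → ℝ → ℝ≥0∞}
    (hg : g x ≠ 0 → g x ≤ ENNReal.ofReal (Real.exp c0) * variancePDF fam a b x)
    (hp : g x ≠ 0 → ∀ i y, p i y ≤ ENNReal.ofReal (Real.exp c1) * gaussianPDF 0 x.toNNReal y)
    (hq : g x ≠ 0 → ∀ j y, q j y ≤ ENNReal.ofReal (Real.exp c1) * gaussianPDF 0 x.toNNReal y)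
    (l : Fin d1 → ℝ) (r : Fin d2 → ℝ) :
    g x * (∏ i, p i (l i)) * (∏ j, q j (r j)) ≤
      ENNReal.ofReal (Real.exp (c0 + (d1 + d2) * c1)) *
        (variancePDF fam a b x * (∏ i, gaussianPDF 0 x.toNNReal (l i)) *
          (∏ j, gaussianPDF 0 x.toNNReal (r j))) := by
  by_cases h0 : g x = 0
  · simp [h0]
  have hexp : ENNReal.ofReal (Real.exp (c0 + (d1 + d2) * c1)) = ENNReal.ofReal (Real.exp c0) *
      ENNReal.ofReal (Real.exp c1) ^ d1 * ENNReal.ofReal (Real.exp c1) ^ d2 := by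
    rw [← ENNReal.ofReal_pow (Real.exp_pos _).le, ← ENNReal.ofReal_pow (Real.exp_pos _).le,
      ← Real.exp_nat_mul, ← Real.exp_nat_mul, ← ENNReal.ofReal_mul (Real.exp_pos _).le,
      ← Real.exp_add, ← ENNReal.ofReal_mul (Real.exp_pos _).le, ← Real.exp_add]
    congr 2; ring
  have hP : ∏ i, p i (l i) ≤ ENNReal.ofReal (Real.exp c1) ^ d1 *
      ∏ i, gaussianPDF 0 x.toNNReal (l i) := by
    calc _ ≤ ∏ i, (ENNReal.ofReal (Real.exp c1) * gaussianPDF 0 x.toNNReal (l i)) :=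
          Finset.prod_le_prod' fun i _ => hp h0 i (l i)
      _ = _ := by rw [Finset.prod_mul_distrib]; simp
  have hQ : ∏ j, q j (r j) ≤ ENNReal.ofReal (Real.exp c1) ^ d2 *
      ∏ j, gaussianPDF 0 x.toNNReal (r j) := by
    calc _ ≤ ∏ j, (ENNReal.ofReal (Real.exp c1) * gaussianPDF 0 x.toNNReal (r j)) :=
          Finset.prod_le_prod' fun j _ => hq h0 j (r j)
      _ = _ := by rw [Finset.prod_mul_distrib]; simp
  calc _ ≤ (ENNReal.ofReal (Real.exp c0) * variancePDF fam a b x) *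
        (ENNReal.ofReal (Real.exp c1) ^ d1 * ∏ i, gaussianPDF 0 x.toNNReal (l i)) *
        (ENNReal.ofReal (Real.exp c1) ^ d2 * ∏ j, gaussianPDF 0 x.toNNReal (r j)) :=
        mul_le_mul' (mul_le_mul' (hg h0) hP) hQ
    _ = _ := by rw [hexp]; ring

end Factorized

/-! ### One-dimensional density comparisons. -/

section OneDimensional

/-- The density of the uniform law on `[lo, hi]`. -/
noncomputable def uniformDensity (lo hi : ℝ) : ℝ → ℝ≥0∞ :=
  (Set.Icc lo hi).indicator fun _ => ENNReal.ofReal (hi - lo)⁻¹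

lemma measurable_uniformDensity (lo hi : ℝ) : Measurable (uniformDensity lo hi) :=
  measurable_const.indicator measurableSet_Icc

lemma lintegral_uniformDensity {lo hi : ℝ} (h : lo < hi) : ∫⁻ x, uniformDensity lo hi x = 1 := by
  rw [uniformDensity, lintegral_indicator measurableSet_Icc, setLIntegral_const, Real.volume_Icc,
    ← ENNReal.ofReal_mul (by simpa using h.le), inv_mul_cancel₀ (sub_pos.mpr h).ne',
    ENNReal.ofReal_one]

lemma mem_of_uniformDensity_ne_zero {lo hi x : ℝ} (h : uniformDensity lo hi x ≠ 0) :
    x ∈ Set.Icc lo hi := Set.mem_of_indicator_ne_zero h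

lemma uniformDensity_le (lo hi x : ℝ) : uniformDensity lo hi x ≤ ENNReal.ofReal (hi - lo)⁻¹ :=
  Set.indicator_le_self' (fun _ _ => zero_le) x

/-- The density of the centered Gaussian law with variance `s`, truncated to `[-t, t]`. -/
noncomputable def truncGaussianDensity (s : NNReal) (t : ℝ) : ℝ → ℝ≥0∞ :=
  (Set.Icc (-t) t).indicator fun x =>
    (gaussianReal 0 s (Set.Icc (-t) t))⁻¹ * gaussianPDF 0 s x

lemma measurable_truncGaussianDensity (s : NNReal) (t : ℝ) :
    Measurable (truncGaussianDensity s t) :=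
  ((measurable_gaussianPDF _ _).const_mul _).indicator measurableSet_Icc

lemma abs_le_of_truncGaussianDensity_ne_zero {s : NNReal} {t x : ℝ}
    (h : truncGaussianDensity s t x ≠ 0) : |x| ≤ t :=
  abs_le.mpr (Set.mem_Icc.mp (Set.mem_of_indicator_ne_zero h))

/-- Chebyshev's inequality for the Gaussian law. -/
lemma le_gaussianReal_Icc (s : NNReal) {t : ℝ} (ht : 0 < t) :
    ENNReal.ofReal (1 - s / t ^ 2) ≤ gaussianReal 0 s (Set.Icc (-t) t) := by
  have h := meas_ge_le_variance_div_sq (μ := gaussianReal 0 s) (X := id)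
    (memLp_id_gaussianReal 2) ht
  rw [variance_id_gaussianReal] at h
  simp only [id_eq, integral_id_gaussianReal] at h
  have hsub : (Set.Icc (-t) t)ᶜ ⊆ {x | t ≤ |x - 0|} := fun x hx => by
    simp only [Set.mem_compl_iff, ← abs_le, Set.mem_Icc, not_le] at hx
    simpa using hx.le
  rw [ENNReal.ofReal_sub _ (by positivity), ENNReal.ofReal_one, tsub_le_iff_right,
    ← prob_add_prob_compl (μ := gaussianReal 0 s) (measurableSet_Icc (a := -t) (b := t))]
  gcongr
  exact (measure_mono hsub).trans h

lemma lintegral_truncGaussianDensity {s : NNReal} (hs : s ≠ 0) {t : ℝ} (ht : 0 < t)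
    (hst : s < t ^ 2) : ∫⁻ x, truncGaussianDensity s t x = 1 := by
  have hpos : gaussianReal 0 s (Set.Icc (-t) t) ≠ 0 := by
    refine (lt_of_lt_of_le ?_ (le_gaussianReal_Icc s ht)).ne'
    rw [ENNReal.ofReal_pos, sub_pos, div_lt_one (by positivity)]
    exact hst
  rw [truncGaussianDensity, lintegral_indicator measurableSet_Icc,
    lintegral_const_mul _ (measurable_gaussianPDF _ _), ← gaussianReal_apply 0 hs]
  exact ENNReal.inv_mul_cancel hpos (measure_ne_top _ _)

/-- Two factors `exp (1 / D)`: by Chebyshev the truncation keeps mass at least `1 - 1 / (2 * D)`,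
and raising the variance from `s` to `v` changes the normalization by at most `√(1 + 1 / D)`, the
exponential only growing. With `D = d1 + d2` the entries of a whole column then cost a constant. -/
lemma truncGaussianDensity_le {s : NNReal} (hs : s ≠ 0) {t D v : ℝ} (ht : 0 < t) (hD : 1 ≤ D)
    (hst : 2 * s * D = t ^ 2) (hv : s ≤ v) (hv' : v ≤ s * (1 + 1 / D)) (x : ℝ) :
    truncGaussianDensity s t x ≤
      ENNReal.ofReal (Real.exp (2 / D)) * gaussianPDF 0 v.toNNReal x := by
  have hs0 : (0 : ℝ) < s := NNReal.coe_pos.mpr (pos_iff_ne_zero.mpr hs)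
  have hv0 : 0 < v := hs0.trans_le hv
  have hZ : (gaussianReal 0 s (Set.Icc (-t) t))⁻¹ ≤ ENNReal.ofReal (Real.exp (1 / D)) := by
    have h1 : (s : ℝ) / t ^ 2 = 1 / (2 * D) := by rw [← hst]; field_simp
    have h2 : 1 ≤ Real.exp (1 / D) * (1 - s / t ^ 2) := by
      have h3 : 1 / D ≤ 1 := by rw [div_le_one (by linarith)]; exact hD
      have h4 : 0 < 1 / D := by positivity
      have h5 : 1 + 1 / D ≤ Real.exp (1 / D) := by linarith [Real.add_one_le_exp (1 / D)]
      rw [h1, show 1 / (2 * D) = 1 / D / 2 by ring]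
      nlinarith
    rw [ENNReal.inv_le_iff_le_mul]
    · calc (1 : ℝ≥0∞) ≤ ENNReal.ofReal (Real.exp (1 / D)) * ENNReal.ofReal (1 - s / t ^ 2) := by
            rw [← ENNReal.ofReal_mul (Real.exp_pos _).le]; exact ENNReal.one_le_ofReal.mpr h2
        _ ≤ _ := by
            rw [mul_comm]; exact mul_le_mul_left (le_gaussianReal_Icc s ht) _
    · intro h; exact absurd h ENNReal.ofReal_ne_top
    · intro h; exact absurd h (measure_ne_top _ _)
  have hφ : gaussianPDFReal 0 s x ≤ Real.exp (1 / D) * gaussianPDFReal 0 v.toNNReal x := by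
    simp only [gaussianPDFReal, Real.coe_toNNReal v hv0.le, sub_zero]
    have e1 : Real.exp (-x ^ 2 / (2 * s)) ≤ Real.exp (-x ^ 2 / (2 * v)) := by
      rw [neg_div, neg_div]; gcongr
    have e2 : √(2 * Real.pi * v) ≤ Real.exp (1 / D) * √(2 * Real.pi * s) := by
      rw [Real.sqrt_le_left (by positivity), mul_pow, Real.sq_sqrt (by positivity)]
      have h5 : 1 + 1 / D ≤ Real.exp (1 / D) := by linarith [Real.add_one_le_exp (1 / D)]
      have h6 : 1 ≤ Real.exp (1 / D) := Real.one_le_exp (by positivity)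
      have h7 : 1 + 1 / D ≤ Real.exp (1 / D) ^ 2 := by nlinarith
      calc 2 * Real.pi * v ≤ 2 * Real.pi * (s * (1 + 1 / D)) := by gcongr
        _ = (1 + 1 / D) * (2 * Real.pi * s) := by ring
        _ ≤ _ := by gcongr
    have e3 : (√(2 * Real.pi * s))⁻¹ ≤ Real.exp (1 / D) * (√(2 * Real.pi * v))⁻¹ := by
      have p1 : 0 < √(2 * Real.pi * s) := Real.sqrt_pos.mpr (by positivity)
      have p2 : 0 < √(2 * Real.pi * v) := Real.sqrt_pos.mpr (by positivity)
      rw [← div_eq_mul_inv, le_div_iff₀ p2, inv_mul_le_iff₀ p1]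
      linarith
    calc _ ≤ (Real.exp (1 / D) * (√(2 * Real.pi * v))⁻¹) * Real.exp (-x ^ 2 / (2 * v)) := by
          gcongr
      _ = _ := by ring
  refine (Set.indicator_le_self' (fun _ _ => zero_le) x).trans ?_
  calc _ ≤ ENNReal.ofReal (Real.exp (1 / D)) * (ENNReal.ofReal (Real.exp (1 / D)) *
        gaussianPDF 0 v.toNNReal x) := by
        refine mul_le_mul' hZ ?_
        rw [gaussianPDF, gaussianPDF, ← ENNReal.ofReal_mul (Real.exp_pos _).le]
        exact ENNReal.ofReal_le_ofReal hφ
    _ = _ := by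
        rw [← mul_assoc, ← ENNReal.ofReal_mul (Real.exp_pos _).le, ← Real.exp_add]
        congr 3; ring

/-- The uniform density is at most `1 / (2 * ε)`. On the window `|x| ≤ A + 1`, and for variances in
`[1, 2]` the Gaussian density is at least `exp (-(A + 1) ^ 2 / 2) / 4`; the remaining factor 2 is
bounded by `exp 1`. -/
lemma uniformDensity_le_gaussianPDF {u ε A v : ℝ} (hu : |u| ≤ A) (hε : 0 < ε) (hε1 : ε ≤ 1)
    (hv : 1 ≤ v) (hv' : v ≤ 2) (x : ℝ) :
    uniformDensity (u - ε) (u + ε) x ≤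
      ENNReal.ofReal (Real.exp (Real.log (1 / ε) + 1 + (A + 1) ^ 2 / 2)) *
        gaussianPDF 0 v.toNNReal x := by
  by_cases hx : x ∈ Set.Icc (u - ε) (u + ε)
  swap
  · rw [uniformDensity, Set.indicator_of_notMem hx]; exact zero_le
  rw [uniformDensity, Set.indicator_of_mem hx, gaussianPDF,
    ← ENNReal.ofReal_mul (Real.exp_pos _).le]
  refine ENNReal.ofReal_le_ofReal ?_
  simp only [gaussianPDFReal, Real.coe_toNNReal v (by linarith), sub_zero]
  have hxA : x ^ 2 ≤ (A + 1) ^ 2 := by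
    have h1 := abs_le.mp hu
    exact sq_le_sq' (by linarith [hx.1]) (by linarith [hx.2])
  have h4 : √(2 * Real.pi * v) ≤ 4 := by
    rw [Real.sqrt_le_left (by norm_num)]
    nlinarith [Real.pi_le_four, Real.pi_pos]
  have hs : 0 < √(2 * Real.pi * v) := Real.sqrt_pos.mpr (by positivity)
  have h5 : 1 / 4 ≤ (√(2 * Real.pi * v))⁻¹ := by
    rw [one_div]; exact inv_anti₀ hs h4
  have h6 : Real.exp (-((A + 1) ^ 2 / 2)) ≤ Real.exp (-x ^ 2 / (2 * v)) := by
    refine Real.exp_le_exp.mpr ?_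
    rw [neg_div, neg_le_neg_iff]
    calc x ^ 2 / (2 * v) ≤ x ^ 2 / (2 * 1) := by gcongr
      _ ≤ _ := by rw [mul_one]; gcongr
  have h7 : (2 : ℝ) ≤ Real.exp 1 := by linarith [Real.add_one_le_exp (1 : ℝ)]
  calc (u + ε - (u - ε))⁻¹ = 1 / ε * 2 * (1 / 4) := by
        rw [show u + ε - (u - ε) = 2 * ε by ring]; field_simp; norm_num
    _ ≤ 1 / ε * Real.exp 1 * (√(2 * Real.pi * v))⁻¹ := by gcongr
    _ = 1 / ε * Real.exp 1 * Real.exp ((A + 1) ^ 2 / 2) *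
        ((√(2 * Real.pi * v))⁻¹ * Real.exp (-((A + 1) ^ 2 / 2))) := by
        rw [Real.exp_neg]; field_simp
    _ ≤ 1 / ε * Real.exp 1 * Real.exp ((A + 1) ^ 2 / 2) *
        ((√(2 * Real.pi * v))⁻¹ * Real.exp (-x ^ 2 / (2 * v))) := by gcongr
    _ = _ := by rw [Real.exp_add, Real.exp_add, Real.exp_log (by positivity)]

/-- In logarithms both densities are linear in `log b` and `log x`, up to an exponential term: `b *
x ≤ 2 * κ` for Gamma, and `b / x` for inverse-Gamma, the only term that could be large at small `x`,
hence `hfam`. -/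
lemma one_le_exp_mul_variancePDF (fam : VarianceFamily) {a b κ Λ T b0 x : ℝ} (ha : 0 < a)
    (hb : 0 < b) (hbκ : b ≤ κ) (hb0 : -b0 ≤ Real.log b) (hx : 0 < x) (hx2 : x ≤ 2)
    (hΛ : |Real.log x| ≤ Λ) (hT : 0 ≤ T) (hfam : fam = VarianceFamily.gamma ∨ b / x ≤ T) :
    1 ≤ ENNReal.ofReal (Real.exp (a * b0 + Real.log (Real.Gamma a) + (a + 1) * Λ + 2 * κ + T)) *
      variancePDF fam a b x := by
  have hΓ := Real.Gamma_pos_of_pos ha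
  have hba : b ^ a / Real.Gamma a = Real.exp (a * Real.log b - Real.log (Real.Gamma a)) := by
    rw [Real.exp_sub, Real.exp_log hΓ, Real.rpow_def_of_pos hb, mul_comm]
  have h1 : -(a * b0) ≤ a * Real.log b := by nlinarith
  have hx' := abs_le.mp hΛ
  have hΛ0 : 0 ≤ Λ := (abs_nonneg _).trans hΛ
  cases fam
  · rw [variancePDF, gammaPDF_of_nonneg hx.le, ← ENNReal.ofReal_mul (Real.exp_pos _).le,
      ENNReal.one_le_ofReal, hba, Real.rpow_def_of_pos hx, ← Real.exp_add, ← Real.exp_add,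
      ← Real.exp_add]
    refine Real.one_le_exp ?_
    have h2 : b * x ≤ κ * 2 := by gcongr; exact hb.le.trans hbκ
    have h3 : -((a + 1) * Λ) ≤ Real.log x * (a - 1) := by nlinarith
    linarith
  · have h2 : b / x ≤ T := by simpa using hfam
    rw [variancePDF, invGammaPDF, if_pos hx, ← ENNReal.ofReal_mul (Real.exp_pos _).le,
      ENNReal.one_le_ofReal, hba, Real.rpow_def_of_pos hx, ← Real.exp_add, ← Real.exp_add,
      ← Real.exp_add]
    refine Real.one_le_exp ?_
    have h3 : -((a + 1) * Λ) ≤ Real.log x * (-a - 1) := by nlinarith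
    linarith

end OneDimensional

/-! ### The competitor near a sign matrix. -/

section Competitor

variable {d1 d2 m : ℕ}

/-- A fully factorized law that concentrates near a given sign matrix `U Vᵀ` and is dominated by the
prior. The columns outside of `S`, where `U` and `V` vanish, have a small variance. -/
lemma exists_competitor (fam : VarianceFamily) {a b A B c0 η δ : ℝ} (ha : 0 < a) (hb : 0 < b)
    (hB : 2 ≤ B) (hA : 0 < A) (hd : 1 ≤ d1 + d2) {U : Matrix (Fin d1) (Fin m) ℝ}
    {V : Matrix (Fin d2) (Fin m) ℝ} (hU : ∀ i k, |U i k| ≤ A) (hV : ∀ j k, |V j k| ≤ A)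
    (S : Finset (Fin m)) (hUS : ∀ i k, k ∉ S → U i k = 0)
    (hM : ∀ i j, (U * V.transpose) i j = 1 ∨ (U * V.transpose) i j = -1)
    (hη : 0 < η) (hη1 : η ≤ 1) (hδ : δ ≤ 1) (hmη : m * η ≤ δ)
    (hact : ∀ x, 1 ≤ x → x ≤ 2 → 1 ≤ ENNReal.ofReal (Real.exp c0) * variancePDF fam a b x)
    (hin : ∀ k ∉ S, ∀ x, η / (2 * (d1 + d2)) ≤ x → x ≤ η / (d1 + d2) →
      1 ≤ ENNReal.ofReal (Real.exp c0) * variancePDF fam a b x) :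
    IsProbabilityMeasure (prior d1 d2 m fam a b B) ∧ ∃ ρ ∈ fullyFactorized d1 d2 m,
      IsProbabilityMeasure ρ ∧
      ρ ≤ ENNReal.ofReal (Real.exp (∑ k : Fin m, if k ∈ S then
        c0 + (d1 + d2) * (Real.log ((2 * A + 1) / η) + 1 + (A + 1) ^ 2 / 2)
        else Real.log (2 * (d1 + d2) ^ 2 / η) + c0 + 2)) • prior d1 d2 m fam a b B ∧
      ∀ᵐ θ ∂ρ, ∀ i j, |toMatrix θ i j - (U * V.transpose) i j| ≤ 2 * δ := by
  set D : ℝ := d1 + d2 with hD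
  have hD1 : 1 ≤ D := by rw [hD]; exact_mod_cast hd
  have hD0 : 0 < D := by linarith
  have hδ0 : 0 ≤ δ := le_trans (by positivity) hmη
  -- Solves `ε * (A + 1) + A * ε = η`, the error of one product of entries in an active column.
  set ε : ℝ := η / (2 * A + 1) with hε
  have hε0 : 0 < ε := by positivity
  have hε1 : ε ≤ 1 := by rw [hε, div_le_one (by positivity)]; linarith
  -- With `t = √η`, two truncated entries have product at most `η`, and `2 * s * D = t ^ 2` makes
  -- the mass lost by truncation at most `1 / (2 * D)`.
  set s : ℝ := η / (2 * D) with hs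
  have hs0 : 0 < s := by positivity
  set t : ℝ := √η with ht
  have ht0 : 0 < t := Real.sqrt_pos.mpr hη
  have ht2 : t ^ 2 = η := Real.sq_sqrt hη.le
  have hsN : s.toNNReal ≠ 0 := by simpa using hs0
  have hsc : (s.toNNReal : ℝ) = s := Real.coe_toNNReal s hs0.le
  have hst : 2 * s * D = t ^ 2 := by rw [ht2, hs]; field_simp
  have hst' : s < t ^ 2 := by nlinarith
  have hss : s < s * (1 + 1 / D) := by
    have : 0 < s * (1 / D) := by positivity
    linarith
  -- The target is shrunk by `1 - δ`: for `B = 2` a sign matrix lies on the boundary of the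
  -- parameter set, and shrinking leaves room for an error `δ`.
  set p : Fin d1 → Fin m → ℝ → ℝ≥0∞ := fun i k => if k ∈ S then
    uniformDensity ((1 - δ) * U i k - ε) ((1 - δ) * U i k + ε)
    else truncGaussianDensity s.toNNReal t with hp
  set q : Fin d2 → Fin m → ℝ → ℝ≥0∞ := fun j k => if k ∈ S then
    uniformDensity (V j k - ε) (V j k + ε) else truncGaussianDensity s.toNNReal t with hq
  -- The inactive window has length `s / D`, hence density `2 * D ^ 2 / η`, whose logarithm is the
  -- cost of the column's variance.
  set g : Fin m → ℝ → ℝ≥0∞ := fun k => if k ∈ S then uniformDensity 1 2 else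
    uniformDensity s (s * (1 + 1 / D)) with hg
  have hUδ : ∀ i k, |(1 - δ) * U i k| ≤ A := fun i k => by
    rw [abs_mul, abs_of_nonneg (by linarith)]
    exact (mul_le_of_le_one_left (abs_nonneg _) (by linarith)).trans (hU i k)
  have hclose : ∀ θ : Params d1 d2 m, (∀ i k, p i k (θ.1 i k) ≠ 0) →
      (∀ j k, q j k (θ.2.1 j k) ≠ 0) →
      ∀ i j, |toMatrix θ i j - (1 - δ) * (U * V.transpose) i j| ≤ δ := by
    intro θ h1 h2 i j
    rw [toMatrix_apply, Matrix.mul_apply, Finset.mul_sum, ← Finset.sum_sub_distrib]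
    refine (Finset.abs_sum_le_sum_abs _ _).trans ?_
    calc _ ≤ ∑ _k : Fin m, η := by
          refine Finset.sum_le_sum fun k _ => ?_
          have h1k := h1 i k
          have h2k := h2 j k
          rw [Matrix.transpose_apply]
          by_cases hk : k ∈ S
          · simp only [hp, hq, if_pos hk] at h1k h2k
            have a1 := mem_of_uniformDensity_ne_zero h1k
            have a2 := mem_of_uniformDensity_ne_zero h2k
            have b1 : |θ.1 i k - (1 - δ) * U i k| ≤ ε :=
              abs_le.mpr ⟨by linarith [a1.1], by linarith [a1.2]⟩
            have b2 : |θ.2.1 j k - V j k| ≤ ε :=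
              abs_le.mpr ⟨by linarith [a2.1], by linarith [a2.2]⟩
            have b3 : |θ.2.1 j k| ≤ A + 1 := by
              have := abs_le.mp (hV j k)
              exact abs_le.mpr ⟨by linarith [a2.1], by linarith [a2.2]⟩
            calc |θ.1 i k * θ.2.1 j k - (1 - δ) * (U i k * V j k)|
                = |(θ.1 i k - (1 - δ) * U i k) * θ.2.1 j k +
                    (1 - δ) * U i k * (θ.2.1 j k - V j k)| := by congr 1; ring
              _ ≤ ε * (A + 1) + A * ε := by
                  refine (abs_add_le _ _).trans ?_
                  rw [abs_mul, abs_mul _ (θ.2.1 j k - V j k)]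
                  exact add_le_add (mul_le_mul b1 b3 (abs_nonneg _) hε0.le)
                    (mul_le_mul (hUδ i k) b2 (abs_nonneg _) hA.le)
              _ = η := by rw [hε]; field_simp; ring
          · simp only [hp, hq, if_neg hk] at h1k h2k
            have a1 := abs_le_of_truncGaussianDensity_ne_zero h1k
            have a2 := abs_le_of_truncGaussianDensity_ne_zero h2k
            rw [hUS i k hk, zero_mul, mul_zero, sub_zero, abs_mul, ← ht2, sq]
            exact mul_le_mul a1 a2 (abs_nonneg _) ht0.le
      _ = m * η := by simp
      _ ≤ δ := hmη
  have habs : ∀ i j, |(U * V.transpose) i j| = 1 := fun i j => by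
    rcases hM i j with h | h <;> simp [h]
  obtain ⟨hprior, ρ, hρF, hρprob, hρle, hρae⟩ := exists_factorized_le_prior (p := p) (q := q)
    (g := g) (B := B) fam ha hb
    (cost := fun k => if k ∈ S then
        c0 + (d1 + d2) * (Real.log ((2 * A + 1) / η) + 1 + (A + 1) ^ 2 / 2)
        else Real.log (2 * D ^ 2 / η) + c0 + (d1 + d2) * (2 / D))
    (fun i k => by
      simp only [hp]; split_ifs
      · exact measurable_uniformDensity _ _
      · exact measurable_truncGaussianDensity _ _)
    (fun i k => by
      simp only [hq]; split_ifs
      · exact measurable_uniformDensity _ _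
      · exact measurable_truncGaussianDensity _ _)
    (fun k => by simp only [hg]; split_ifs <;> exact measurable_uniformDensity _ _)
    (fun i k => by
      simp only [hp]; split_ifs
      · exact lintegral_uniformDensity (by linarith)
      · exact lintegral_truncGaussianDensity hsN ht0 (by rw [hsc]; exact hst'))
    (fun i k => by
      simp only [hq]; split_ifs
      · exact lintegral_uniformDensity (by linarith)
      · exact lintegral_truncGaussianDensity hsN ht0 (by rw [hsc]; exact hst'))
    (fun k => by
      simp only [hg]; split_ifs
      · exact lintegral_uniformDensity (by norm_num)
      · exact lintegral_uniformDensity hss)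
    (by
      intro k x l r
      by_cases hk : k ∈ S
      · simp only [hp, hq, hg, if_pos hk]
        refine prod_column_le (g := uniformDensity 1 2)
          (p := fun i => uniformDensity ((1 - δ) * U i k - ε) ((1 - δ) * U i k + ε))
          (q := fun j => uniformDensity (V j k - ε) (V j k + ε)) (fun hx => ?_)
          (fun hx i y => ?_) (fun hx j y => ?_) l r
        · have hx := mem_of_uniformDensity_ne_zero hx
          refine (uniformDensity_le _ _ _).trans ?_
          norm_num
          exact hact x hx.1 hx.2
        · have hx := mem_of_uniformDensity_ne_zero hx
          have := uniformDensity_le_gaussianPDF (hUδ i k) hε0 hε1 hx.1 hx.2 y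
          rwa [hε, one_div_div] at this
        · have hx := mem_of_uniformDensity_ne_zero hx
          have := uniformDensity_le_gaussianPDF (hV j k) hε0 hε1 hx.1 hx.2 y
          rwa [hε, one_div_div] at this
      · simp only [hp, hq, hg, if_neg hk]
        refine prod_column_le (g := uniformDensity s (s * (1 + 1 / D)))
          (p := fun i => truncGaussianDensity s.toNNReal t)
          (q := fun j => truncGaussianDensity s.toNNReal t) (fun hx => ?_)
          (fun hx i y => ?_) (fun hx j y => ?_) l r
        · have hx := mem_of_uniformDensity_ne_zero hx
          have hx2 : x ≤ η / D := by
            refine hx.2.trans ?_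
            have h1 : 1 / D ≤ 1 := by rw [div_le_one hD0]; exact hD1
            calc s * (1 + 1 / D) ≤ s * (1 + 1) := by gcongr
              _ = η / D := by rw [hs]; field_simp; norm_num
          refine (uniformDensity_le _ _ _).trans ?_
          have e : (s * (1 + 1 / D) - s)⁻¹ = 2 * D ^ 2 / η := by rw [hs]; field_simp; ring
          rw [e, Real.exp_add, Real.exp_log (by positivity), ENNReal.ofReal_mul (by positivity),
            mul_assoc]
          exact le_mul_of_one_le_right' (hin k hk x hx.1 hx2)
        all_goals
          have hx := mem_of_uniformDensity_ne_zero hx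
          exact truncGaussianDensity_le hsN ht0 hD1 (by rw [hsc]; exact hst)
            (by rw [hsc]; exact hx.1) (by rw [hsc]; exact hx.2) y)
    (by
      intro θ h1 h2
      refine mem_paramSet_of_abs_le (fun i j => ?_) (by linarith)
      have h3 := hclose θ h1 h2 i j
      have h4 : |(1 - δ) * (U * V.transpose) i j| = 1 - δ := by
        rw [abs_mul, habs, mul_one, abs_of_nonneg (by linarith)]
      have h5 := abs_sub_abs_le_abs_sub (toMatrix θ i j) ((1 - δ) * (U * V.transpose) i j)
      linarith)
  refine ⟨hprior, ρ, hρF, hρprob, ?_, ?_⟩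
  · have : (d1 + d2 : ℝ) * (2 / D) = 2 := by rw [← hD]; field_simp
    simpa only [this] using hρle
  · filter_upwards [hρae] with θ hθ i j
    have h3 := hclose θ hθ.1 hθ.2 i j
    calc |toMatrix θ i j - (U * V.transpose) i j|
        = |(toMatrix θ i j - (1 - δ) * (U * V.transpose) i j) -
            δ * (U * V.transpose) i j| := by congr 1; ring
      _ ≤ δ + δ := by
          refine (abs_sub _ _).trans (add_le_add h3 ?_)
          rw [abs_mul, habs, mul_one, abs_of_nonneg hδ0]
      _ = 2 * δ := by ring

end Competitor

/-! ### From excess hinge risk to misclassification risk. -/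

section Conclusion

variable {d1 d2 m n : ℕ}

lemma isProbabilityMeasure_gibbs (π : Measure (Params d1 d2 m)) [IsProbabilityMeasure π] {lam : ℝ}
    (hlam : 0 ≤ lam) (D : Fin n → Obs d1 d2) : IsProbabilityMeasure (gibbs π lam D) := by
  refine isProbabilityMeasure_tilted (Integrable.of_bound (C := 1) ?_ ?_)
  · exact Measurable.aestronglyMeasurable (by fun_prop)
  · refine .of_forall fun θ => ?_
    rw [Real.norm_eq_abs, Real.abs_exp, Real.exp_le_one_iff, neg_mul, Left.neg_nonpos_iff]
    exact mul_nonneg hlam (empHingeRisk_nonneg _ _)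

/-- From the excess hinge risk to the misclassification risk of the randomized and of the mean
estimator. -/
lemma misclassRisk_le_of_excess_le (P : Measure (Obs d1 d2)) [IsProbabilityMeasure P]
    {Ms : Matrix (Fin d1) (Fin d2) ℝ} (hMs : IsBayesMatrix P Ms) {B X : ℝ}
    (ρ : (Fin n → Obs d1 d2) → Measure (Params d1 d2 m)) [∀ D, IsProbabilityMeasure (ρ D)]
    (hρ : ∀ D, ∀ᵐ θ ∂(ρ D), θ ∈ paramSet d1 d2 m B)
    (hX : ∫ D, (∫ θ, (hingeRisk P (toMatrix θ) - hingeRisk P Ms) ∂(ρ D))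
        ∂(Measure.pi fun _ : Fin n => P) ≤ X) :
    (∫ D, (∫ θ, misclassRisk P (toMatrix θ) ∂(ρ D)) ∂(Measure.pi fun _ : Fin n => P)) -
        bayesRisk P ≤ X ∧
      (∫ D, misclassRisk P (meanMatrix (ρ D)) ∂(Measure.pi fun _ : Fin n => P)) -
        bayesRisk P ≤ X := by
  have hi : ∀ D, Integrable (fun θ => hingeRisk P (toMatrix θ)) (ρ D) := fun D => by
    refine Integrable.of_bound (measurable_hingeRisk_toMatrix P).aestronglyMeasurable B ?_
    filter_upwards [hρ D] with θ hθ
    rw [Real.norm_eq_abs, abs_of_nonneg (hingeRisk_nonneg _ _)]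
    exact hingeRisk_le_of_mem_paramSet P hθ
  have hmi : ∀ D, Integrable (fun θ => misclassRisk P (toMatrix θ)) (ρ D) := fun D => by
    refine Integrable.of_bound (measurable_misclassRisk_toMatrix P).aestronglyMeasurable 1 ?_
    refine .of_forall fun θ => ?_
    rw [Real.norm_eq_abs, abs_of_nonneg (misclassRisk_nonneg _ _)]
    exact misclassRisk_le_one P _
  have hti : ∀ D i j, Integrable (fun θ => toMatrix θ i j) (ρ D) := fun D i j => by
    refine Integrable.of_bound (measurable_toMatrix_apply i j).aestronglyMeasurable (B - 1) ?_
    filter_upwards [hρ D] with θ hθ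
    exact abs_toMatrix_le hθ i j
  have hex : ∀ D, ∫ θ, (hingeRisk P (toMatrix θ) - hingeRisk P Ms) ∂(ρ D) =
      (∫ θ, hingeRisk P (toMatrix θ) ∂(ρ D)) - hingeRisk P Ms := fun D => by
    rw [integral_sub (hi D) (integrable_const _)]; simp
  constructor
  · rw [sub_le_iff_le_add]
    calc _ ≤ ∫ D, ((∫ θ, (hingeRisk P (toMatrix θ) - hingeRisk P Ms) ∂(ρ D)) + bayesRisk P)
          ∂(Measure.pi fun _ : Fin n => P) := by
          refine integral_mono .of_finite .of_finite fun D => ?_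
          have : ∫ θ, misclassRisk P (toMatrix θ) ∂(ρ D) ≤
              ∫ θ, (hingeRisk P (toMatrix θ) + (bayesRisk P - hingeRisk P Ms)) ∂(ρ D) := by
            refine integral_mono (hmi D) ((hi D).add (integrable_const _)) fun θ => ?_
            have := misclassRisk_sub_bayesRisk_le P hMs (toMatrix θ)
            simp only
            linarith
          rw [integral_add (hi D) (integrable_const _)] at this
          simp only [integral_const, probReal_univ, one_smul] at this
          simp only
          rw [hex]
          linarith
      _ ≤ X + bayesRisk P := by
          rw [integral_add .of_finite .of_finite]
          simpa using hX
  · rw [sub_le_iff_le_add]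
    calc _ ≤ ∫ D, ((∫ θ, (hingeRisk P (toMatrix θ) - hingeRisk P Ms) ∂(ρ D)) + bayesRisk P)
          ∂(Measure.pi fun _ : Fin n => P) := by
          refine integral_mono .of_finite .of_finite fun D => ?_
          have h1 := hingeRisk_meanMatrix_le P (ρ D) (hti D)
          have h2 := misclassRisk_sub_bayesRisk_le P hMs (meanMatrix (ρ D))
          simp only
          rw [hex]
          linarith
      _ ≤ X + bayesRisk P := by
          rw [integral_add .of_finite .of_finite]
          simpa using hX

lemma misclassRisk_le_of_one_le (P : Measure (Obs d1 d2)) [IsProbabilityMeasure P] {X : ℝ}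
    (hX : 1 ≤ X) (ρ : (Fin n → Obs d1 d2) → Measure (Params d1 d2 m))
    [∀ D, IsProbabilityMeasure (ρ D)] :
    (∫ D, (∫ θ, misclassRisk P (toMatrix θ) ∂(ρ D)) ∂(Measure.pi fun _ : Fin n => P)) -
        bayesRisk P ≤ X := by
  have h : ∀ D, ∫ θ, misclassRisk P (toMatrix θ) ∂(ρ D) ≤ 1 := fun D => by
    calc _ ≤ ∫ _, (1 : ℝ) ∂(ρ D) := integral_mono_of_nonneg
            (.of_forall fun _ => measureReal_nonneg) (integrable_const _)
            (.of_forall fun _ => misclassRisk_le_one P _)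
      _ = 1 := by simp
  have := integral_mono (μ := Measure.pi fun _ : Fin n => P) .of_finite .of_finite h
  simp only [integral_const, probReal_univ, one_smul] at this
  linarith [bayesRisk_nonneg P]

lemma integral_misclassRisk_sub_le_of_one_le (P : Measure (Obs d1 d2)) [IsProbabilityMeasure P]
    {X : ℝ} (hX : 1 ≤ X) (M : (Fin n → Obs d1 d2) → Matrix (Fin d1) (Fin d2) ℝ) :
    (∫ D, misclassRisk P (M D) ∂(Measure.pi fun _ : Fin n => P)) - bayesRisk P ≤ X := by
  have := integral_mono (μ := Measure.pi fun _ : Fin n => P) .of_finite .of_finite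
    fun D => misclassRisk_le_one P (M D)
  simp only [integral_const, probReal_univ, one_smul] at this
  linarith [bayesRisk_nonneg P]

end Conclusion

/-! ### Bookkeeping of the costs. -/

section Rates

/-- The constant bounding the cost of one variance coordinate of the competitor, in units of
`log (n d1 d2)`. -/
noncomputable def varianceCost (a κ : ℝ) : ℝ :=
  2 * a * Real.log κ + a * κ + 2 * |Real.log (Real.Gamma a)| +
    (a + 1) * (2 * Real.log (2 * κ) + 3) + 4 * κ + 8 * κ ^ 2

/-- The constant bounding the cost of the competitor, in units of `r (d1 + d2) log (n d1 d2)`. -/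
noncomputable def competitorCost (a A κ : ℝ) : ℝ :=
  κ * (2 * varianceCost a κ + 2 * Real.log ((2 * A + 1) * κ) + (A + 1) ^ 2 + 2 * Real.log (2 * κ)
    + 12)

lemma varianceCost_nonneg {a κ : ℝ} (ha : 0 < a) (hκ : 1 ≤ κ) : 0 ≤ varianceCost a κ := by
  have h1 := Real.log_nonneg hκ
  have h2 : 0 ≤ Real.log (2 * κ) := Real.log_nonneg (by linarith)
  unfold varianceCost
  positivity

lemma competitorCost_nonneg {a A κ : ℝ} (ha : 0 < a) (hA : 0 < A) (hκ : 1 ≤ κ) :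
    0 ≤ competitorCost a A κ := by
  have h0 := varianceCost_nonneg ha hκ
  have h1 : 0 ≤ Real.log ((2 * A + 1) * κ) := Real.log_nonneg (by nlinarith)
  have h2 : 0 ≤ Real.log (2 * κ) := Real.log_nonneg (by linarith)
  unfold competitorCost
  positivity

/-- Since `l ≥ 1 / 2`, a nonnegative constant `x` is at most `2 * x * l`; this puts every constant
on the logarithmic scale. -/
lemma varianceExponent_le {a κ l : ℝ} (ha : 0 < a) (hκ : 1 ≤ κ) (hl : 1 / 2 ≤ l) :
    a * (Real.log κ + κ * l) + Real.log (Real.Gamma a) + (a + 1) * (Real.log (2 * κ) + 3 * l) +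
      2 * κ + 4 * κ ^ 2 ≤ varianceCost a κ * l := by
  have hx : ∀ x : ℝ, 0 ≤ x → x ≤ 2 * x * l := fun x hx => by nlinarith
  have h1 := hx _ (Real.log_nonneg hκ)
  have h2 := hx _ (Real.log_nonneg (by linarith : 1 ≤ 2 * κ))
  have h3 := hx _ (abs_nonneg (Real.log (Real.Gamma a)))
  have h4 := hx κ (by linarith)
  have h5 := hx (κ ^ 2) (by positivity)
  have h6 := le_abs_self (Real.log (Real.Gamma a))
  have h7 := mul_le_mul_of_nonneg_left h1 ha.le
  have h8 := mul_le_mul_of_nonneg_left h2 (by linarith : 0 ≤ a + 1)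
  unfold varianceCost
  linarith

/-- The total cost of the competitor. -/
lemma sum_cost_le {m r : ℕ} {a A κ l D n c0 η : ℝ} (ha : 0 < a) (hA : 0 < A) (hκ : 1 ≤ κ)
    (hl : 1 / 2 ≤ l) (hD : 1 ≤ D) (hr : 1 ≤ r) (hn : 1 ≤ n) (hnl : Real.log n ≤ l) (hDn : D ≤ n)
    (hη : η = 1 / (κ * n ^ 2)) (hc0 : c0 ≤ varianceCost a κ * l) (S : Finset (Fin m))
    (hS : (S.card : ℝ) ≤ κ * r) (hS' : (Sᶜ.card : ℝ) ≤ κ * D) :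
    (∑ k : Fin m, if k ∈ S then c0 + D * (Real.log ((2 * A + 1) / η) + 1 + (A + 1) ^ 2 / 2)
        else Real.log (2 * D ^ 2 / η) + c0 + 2) ≤ competitorCost a A κ * (r * D * l) := by
  have hx : ∀ x : ℝ, 0 ≤ x → x ≤ 2 * x * l := fun x hx => by nlinarith
  have hn0 : 0 < n := by linarith
  have hD0 : 0 < D := by linarith
  have hκ0 : 0 < κ := by linarith
  have hr1 : (1 : ℝ) ≤ r := by exact_mod_cast hr
  have hG := varianceCost_nonneg ha hκ
  set G := varianceCost a κ
  have hl1 : 0 ≤ Real.log ((2 * A + 1) * κ) := Real.log_nonneg (by nlinarith)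
  have hl2 : 0 ≤ Real.log (2 * κ) := Real.log_nonneg (by linarith)
  have e1 : Real.log ((2 * A + 1) / η) = Real.log ((2 * A + 1) * κ) + 2 * Real.log n := by
    rw [hη, show (2 * A + 1) / (1 / (κ * n ^ 2)) = (2 * A + 1) * κ * n ^ 2 by field_simp,
      Real.log_mul (by positivity) (by positivity), Real.log_pow]
    norm_num
  have e2 : Real.log (2 * D ^ 2 / η) = Real.log (2 * κ) + 2 * Real.log n + 2 * Real.log D := by
    rw [hη, show 2 * D ^ 2 / (1 / (κ * n ^ 2)) = 2 * κ * n ^ 2 * D ^ 2 by field_simp,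
      Real.log_mul (by positivity) (by positivity), Real.log_mul (by positivity) (by positivity),
      Real.log_pow, Real.log_pow]
    norm_num
  have hDl : Real.log D ≤ l := (Real.log_le_log hD0 hDn).trans hnl
  set G1 := 2 * Real.log ((2 * A + 1) * κ) + 4 + (A + 1) ^ 2 with hG1
  set G2 := 2 * Real.log (2 * κ) + 8 with hG2
  have hG1' : 0 ≤ G1 := by positivity
  have hG2' : 0 ≤ G2 := by positivity
  have hl0 : 0 < l := by linarith
  have hact : c0 + D * (Real.log ((2 * A + 1) / η) + 1 + (A + 1) ^ 2 / 2) ≤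
      (G + G1) * (D * l) := by
    have h1 : Real.log ((2 * A + 1) / η) + 1 + (A + 1) ^ 2 / 2 ≤ G1 * l := by
      rw [e1, hG1]
      have := hx _ hl1
      have := hx ((A + 1) ^ 2 / 2) (by positivity)
      linarith
    have h2 : G * l ≤ G * (D * l) := by gcongr; nlinarith
    have h3 := mul_le_mul_of_nonneg_left h1 hD0.le
    linarith
  have hina : Real.log (2 * D ^ 2 / η) + c0 + 2 ≤ (G + G2) * l := by
    rw [e2, hG2]
    have := hx _ hl2
    linarith
  rw [Finset.sum_ite, Finset.sum_const, Finset.sum_const, nsmul_eq_mul, nsmul_eq_mul,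
    Finset.filter_mem_eq_inter, Finset.univ_inter, ← Finset.compl_filter,
    Finset.filter_mem_eq_inter, Finset.univ_inter]
  -- At most `κ * r` active columns of cost of order `D * l`, and at most `κ * D` inactive ones of
  -- order `l`; `r ≥ 1` brings the second sum to the scale of the first.
  calc _ ≤ (S.card : ℝ) * ((G + G1) * (D * l)) + (Sᶜ.card : ℝ) * ((G + G2) * l) := by gcongr
    _ ≤ κ * r * ((G + G1) * (D * l)) + κ * D * ((G + G2) * l) := by gcongr
    _ ≤ κ * r * ((G + G1) * (D * l)) + r * (κ * D * ((G + G2) * l)) := by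
        have h3 : 0 ≤ κ * D * ((G + G2) * l) := by positivity
        linarith [le_mul_of_one_le_left h3 hr1]
    _ = competitorCost a A κ * (r * D * l) := by
        simp only [competitorCost, hG1, hG2]; ring

end Rates

/-! ### Choice of the parameters and the final rate. -/

/-- The bounds on the variance density along the supports of the competitor. -/
lemma one_le_variancePDF_of_rate {n d1 d2 : ℕ} (hn : 1 ≤ n) (h1 : 1 ≤ d1) (h2 : 1 ≤ d2)
    (hN : 2 ≤ n * d1 * d2) (hDn : d1 + d2 ≤ n) (fam : VarianceFamily) {a b κ x : ℝ} (ha : 0 < a)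
    (hκ : 1 ≤ κ) (hb : 1 / (κ * ((n * d1 * d2 : ℕ) : ℝ) ^ κ) ≤ b) (hbκ : b ≤ κ)
    (hx : (1 ≤ x ∧ x ≤ 2) ∨ ((fam = VarianceFamily.gamma ∨ b ≤ κ / ((n * d1 * d2 : ℕ) : ℝ) ^ 4) ∧
      1 / (κ * (n : ℝ) ^ 2) / (2 * (d1 + d2)) ≤ x ∧ x ≤ 1 / (κ * (n : ℝ) ^ 2) / (d1 + d2))) :
    1 ≤ ENNReal.ofReal (Real.exp (a * (Real.log κ + κ * Real.log ((n * d1 * d2 : ℕ) : ℝ)) +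
      Real.log (Real.Gamma a) + (a + 1) * (Real.log (2 * κ) +
        3 * Real.log ((n * d1 * d2 : ℕ) : ℝ)) + 2 * κ + 4 * κ ^ 2)) * variancePDF fam a b x := by
  set N : ℝ := ((n * d1 * d2 : ℕ) : ℝ) with hNdef
  have hN2 : 2 ≤ N := by rw [hNdef]; exact_mod_cast hN
  have hN0 : 0 < N := by linarith
  have hκ0 : 0 < κ := by linarith
  have hb0 : 0 < b := lt_of_lt_of_le (by positivity) hb
  have hn1 : (1 : ℝ) ≤ n := by exact_mod_cast hn
  have hd1 : (1 : ℝ) ≤ d1 := by exact_mod_cast h1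
  have hd2 : (1 : ℝ) ≤ d2 := by exact_mod_cast h2
  have hD2 : (d1 + d2 : ℝ) ≤ 2 * (d1 * d2) := by nlinarith
  have hDn' : (d1 + d2 : ℝ) ≤ n := by exact_mod_cast hDn
  have hNeq : N = n * (d1 * d2) := by rw [hNdef]; push_cast; ring
  have hdd : (1 : ℝ) ≤ d1 * d2 := by nlinarith
  have hnN : (n : ℝ) ≤ N := by rw [hNeq]; nlinarith
  set D : ℝ := (d1 : ℝ) + d2 with hD
  have hD0 : 0 < D := by linarith
  have hlκ : 0 ≤ Real.log (2 * κ) := Real.log_nonneg (by linarith)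
  have hlN : Real.log 2 ≤ Real.log N := Real.log_le_log (by norm_num) hN2
  have hl2 : 0 < Real.log 2 := Real.log_pos (by norm_num)
  -- A lower bound on `b` that is polynomial in `1 / N` costs only a multiple of `log N`.
  have hlogb : -(Real.log κ + κ * Real.log N) ≤ Real.log b := by
    rw [← Real.log_rpow hN0, ← Real.log_mul hκ0.ne' (by positivity), ← Real.log_inv, ← one_div]
    exact Real.log_le_log (by positivity) hb
  rcases hx with ⟨hx1, hx2⟩ | ⟨hfam, hx1, hx2⟩
  · have hx0 : 0 < x := by linarith
    refine one_le_exp_mul_variancePDF fam ha hb0 hbκ hlogb hx0 hx2 ?_ (by positivity) (Or.inr ?_)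
    · rw [abs_of_nonneg (Real.log_nonneg hx1)]
      linarith [Real.log_le_log hx0 hx2]
    · calc b / x ≤ b := div_le_self hb0.le hx1
        _ ≤ κ := hbκ
        _ ≤ 4 * κ ^ 2 := by nlinarith
  · have hx0 : 0 < x := lt_of_lt_of_le (by positivity) hx1
    have hx3 : x ≤ 1 := by
      refine hx2.trans ?_
      rw [div_div, div_le_one (by positivity)]
      have : 1 ≤ κ * (n : ℝ) ^ 2 := one_le_mul_of_one_le_of_one_le hκ (one_le_pow₀ hn1)
      nlinarith
    refine one_le_exp_mul_variancePDF fam ha hb0 hbκ hlogb hx0 (by linarith) ?_ (by positivity)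
      (hfam.imp_right fun hb4 => ?_)
    · rw [abs_of_nonpos (Real.log_nonpos hx0.le hx3), neg_le]
      refine le_trans ?_ (Real.log_le_log (by positivity) hx1)
      have e : 1 / (κ * (n : ℝ) ^ 2) / (2 * D) = (2 * κ * n ^ 2 * D)⁻¹ := by
        field_simp
      rw [e, Real.log_inv, Real.log_mul (x := 2 * κ * n ^ 2) (by positivity) hD0.ne',
        Real.log_mul (x := 2 * κ) (by positivity) (by positivity), Real.log_pow]
      have h3 := Real.log_le_log (by linarith) hnN
      have h4 := Real.log_le_log hD0 (hDn'.trans hnN)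
      push_cast
      linarith
    -- At the small scale `1 / x ≤ 2 * κ * n ^ 2 * D` is polynomial in `N`, and the smallness of `b`
    -- compensates it.
    · have hnD : (n : ℝ) ^ 2 * D ≤ 2 * N ^ 4 := by
        calc (n : ℝ) ^ 2 * D ≤ n ^ 2 * (2 * (d1 * d2) ^ 2) := by
              refine mul_le_mul_of_nonneg_left ?_ (by positivity)
              nlinarith
          _ = 2 * N ^ 2 := by rw [hNeq]; ring
          _ ≤ 2 * N ^ 4 := mul_le_mul_of_nonneg_left
              (pow_le_pow_right₀ (by linarith) (by norm_num)) (by norm_num)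
      calc b / x ≤ κ / N ^ 4 / (1 / (κ * (n : ℝ) ^ 2) / (2 * D)) := by gcongr
        _ = 2 * κ ^ 2 * (n ^ 2 * D) / N ^ 4 := by field_simp
        _ ≤ 2 * κ ^ 2 * (2 * N ^ 4) / N ^ 4 := by gcongr
        _ = 4 * κ ^ 2 := by field_simp; ring

/-- The expected excess hinge risk bound, when the sample is not too small. -/
lemma integral_excess_le_rate {K B A a κ : ℝ} (hK : 0 < K) (hB : 2 ≤ B) (hA : 0 < A) (ha : 0 < a)
    (hκ : 1 ≤ κ) {n d1 d2 m r : ℕ} (hN : 2 ≤ n * d1 * d2) (hr : 1 ≤ r) (hrn : r * (d1 + d2) ≤ n)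
    (P : Measure (Obs d1 d2)) [IsProbabilityMeasure P] (fam : VarianceFamily) {b : ℝ}
    (hb : 1 / (κ * ((n * d1 * d2 : ℕ) : ℝ) ^ κ) ≤ b ∧ b ≤ κ)
    (hm : (m : ℝ) ≤ κ * r ∨ ((m : ℝ) ≤ κ * (d1 + d2) ∧
      (fam = VarianceFamily.gamma ∨ b ≤ κ / ((n * d1 * d2 : ℕ) : ℝ) ^ 4)))
    {U : Matrix (Fin d1) (Fin m) ℝ} {V : Matrix (Fin d2) (Fin m) ℝ}
    (hUV : (U, V) ∈ factorClass d1 d2 m r A) (hBayes : IsBayesMatrix P (U * V.transpose))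
    (hbern : ∀ θ ∈ paramSet d1 d2 m B, sqDist P (toMatrix θ) (U * V.transpose) ≤
      K * (hingeRisk P (toMatrix θ) - hingeRisk P (U * V.transpose)))
    {lam : ℝ} (hlam : lam = n / max (2 * K) B) :
    IsProbabilityMeasure (prior d1 d2 m fam a b B) ∧ ∃ ρ' ∈ fullyFactorized d1 d2 m,
      ∀ ρ : (Fin n → Obs d1 d2) → Measure (Params d1 d2 m), (∀ D, IsProbabilityMeasure (ρ D)) →
      (∀ D, InformationTheory.klDiv (ρ D) (gibbs (prior d1 d2 m fam a b B) lam D) ≤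
        InformationTheory.klDiv ρ' (gibbs (prior d1 d2 m fam a b B) lam D)) →
      (∀ D, ρ D ≪ prior d1 d2 m fam a b B) ∧
      ∫ D, (∫ θ, (hingeRisk P (toMatrix θ) - hingeRisk P (U * V.transpose)) ∂(ρ D))
        ∂(Measure.pi fun _ : Fin n => P) ≤
        (2 * max (2 * K) B * competitorCost a A κ + 8) *
          (r * (d1 + d2) * Real.log ((n * d1 * d2 : ℕ) : ℝ) / n) := by
  have hn : 1 ≤ n := Nat.one_le_iff_ne_zero.mpr fun h => by simp [h] at hN
  have h1 : 1 ≤ d1 := Nat.one_le_iff_ne_zero.mpr fun h => by simp [h] at hN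
  have h2 : 1 ≤ d2 := Nat.one_le_iff_ne_zero.mpr fun h => by simp [h] at hN
  have hDn : d1 + d2 ≤ n := (Nat.le_mul_of_pos_left _ hr).trans hrn
  have hrn' : r ≤ n := (Nat.le_mul_of_pos_right _ (by omega)).trans hrn
  have hn1 : (1 : ℝ) ≤ n := by exact_mod_cast hn
  have hn0 : (0 : ℝ) < n := by linarith
  have hκ0 : 0 < κ := by linarith
  have hrr : (1 : ℝ) ≤ r := by exact_mod_cast hr
  have hD1 : (1 : ℝ) ≤ d1 + d2 := by exact_mod_cast (by omega : 1 ≤ d1 + d2)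
  have hDn' : (d1 + d2 : ℝ) ≤ n := by exact_mod_cast hDn
  have hrn'' : (r : ℝ) ≤ n := by exact_mod_cast hrn'
  obtain ⟨hU, hV, hU0, hV0⟩ := hUV
  set l := Real.log ((n * d1 * d2 : ℕ) : ℝ) with hl
  have hl12 : 1 / 2 ≤ l := by
    have : Real.log 2 ≤ l := Real.log_le_log (by norm_num) (by exact_mod_cast hN)
    linarith [Real.log_two_gt_d9]
  have hnl : Real.log n ≤ l := Real.log_le_log hn0 (by
    exact_mod_cast (Nat.le_mul_of_pos_right n h1).trans (Nat.le_mul_of_pos_right _ h2))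
  have hmn : (m : ℝ) ≤ κ * n := by
    rcases hm with h | h
    · exact h.trans (by gcongr)
    · exact h.1.trans (by gcongr)
  -- If `m ≤ κ * r` every column can be treated as active and no small variance occurs, so neither
  -- law nor scale is restricted; otherwise only the first `r` columns are active.
  obtain ⟨S, hUS, hScard, hSc, hSfam⟩ : ∃ S : Finset (Fin m), (∀ i k, k ∉ S → U i k = 0) ∧
      ((S.card : ℝ) ≤ κ * r) ∧ ((Sᶜ.card : ℝ) ≤ κ * (d1 + d2)) ∧
      (∀ k ∉ S, fam = VarianceFamily.gamma ∨ b ≤ κ / ((n * d1 * d2 : ℕ) : ℝ) ^ 4) := by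
    rcases hm with h | h
    · refine ⟨Finset.univ, fun i k hk => absurd (Finset.mem_univ k) hk, by simpa using h, ?_,
        fun k hk => absurd (Finset.mem_univ k) hk⟩
      simp only [Finset.compl_univ, Finset.card_empty, Nat.cast_zero]
      positivity
    · refine ⟨Finset.univ.filter fun k : Fin m => (k : ℕ) < r, fun i k hk => hU0 i k ?_, ?_, ?_,
        fun _ _ => h.2⟩
      · simpa using hk
      · have : (Finset.univ.filter fun k : Fin m => (k : ℕ) < r).card ≤ r := by
          calc _ = ((Finset.univ.filter fun k : Fin m => (k : ℕ) < r).map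
                Fin.valEmbedding).card := (Finset.card_map _).symm
            _ ≤ (Finset.range r).card := Finset.card_le_card fun x hx => by
                simp only [Finset.mem_map, Finset.mem_filter] at hx
                obtain ⟨k, hk, rfl⟩ := hx
                exact Finset.mem_range.mpr hk.2
            _ = r := Finset.card_range r
        have h3 : ((Finset.univ.filter fun k : Fin m => (k : ℕ) < r).card : ℝ) ≤ r := by
          exact_mod_cast this
        nlinarith
      · refine le_trans ?_ h.1
        exact_mod_cast (Finset.card_le_univ _).trans_eq (Fintype.card_fin m)
  set c0 : ℝ := a * (Real.log κ + κ * l) + Real.log (Real.Gamma a) +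
    (a + 1) * (Real.log (2 * κ) + 3 * l) + 2 * κ + 4 * κ ^ 2 with hc0
  -- As `r` and `d1 + d2` are at most `n`, so is `m / κ`; this `η` gives `m * η ≤ 1 / n`, and `δ = 1
  -- / n` is below the rate.
  set η : ℝ := 1 / (κ * (n : ℝ) ^ 2) with hη
  have hη0 : 0 < η := by positivity
  have hη1 : η ≤ 1 := by
    rw [hη, div_le_one (by positivity)]
    exact one_le_mul_of_one_le_of_one_le hκ (one_le_pow₀ hn1)
  have hδ1 : 1 / (n : ℝ) ≤ 1 := by rw [div_le_one hn0]; exact hn1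
  have hmη : m * η ≤ 1 / n := by
    calc m * η ≤ κ * n * η := by gcongr
      _ = 1 / n := by rw [hη]; field_simp
  obtain ⟨hprior, ρ', hρ'F, hρ'prob, hρ'le, hρ'ae⟩ := exists_competitor (c0 := c0) fam ha
    (lt_of_lt_of_le (by positivity) hb.1) hB hA (by omega : 1 ≤ d1 + d2) hU hV S hUS
    (fun i j => (hBayes i j).1) hη0 hη1 hδ1 hmη
    (fun x hx hx' => one_le_variancePDF_of_rate hn h1 h2 hN hDn fam ha hκ hb.1 hb.2
      (Or.inl ⟨hx, hx'⟩))
    (fun k hk x hx hx' => one_le_variancePDF_of_rate hn h1 h2 hN hDn fam ha hκ hb.1 hb.2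
      (Or.inr ⟨hSfam k hk, hx, hx'⟩))
  refine ⟨hprior, ρ', hρ'F, fun ρ hρ hkl => ?_⟩
  have hmain := integral_excess_le_of_klDiv_le P hK hB (by omega) (fun i j => (hBayes i j).1) hbern
    hlam (prior d1 d2 m fam a b B) (ae_cond_mem (measurableSet_paramSet B)) ρ' hρ'le (by positivity) hρ'ae ρ hkl
  refine ⟨hmain.1, hmain.2.trans ?_⟩
  have hcost := sum_cost_le (D := (d1 : ℝ) + d2) (m := m) ha hA hκ hl12 hD1 hr hn1 hnl hDn' hη
    (varianceExponent_le ha hκ hl12) S hScard hSc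
  rw [← hc0] at hcost
  have hM : 0 < max (2 * K) B := lt_of_lt_of_le (by linarith) (le_max_right _ _)
  have hrDl : 1 ≤ 2 * (r * (d1 + d2) * l) := by
    have : 1 ≤ (r : ℝ) * (d1 + d2) := one_le_mul_of_one_le_of_one_le hrr hD1
    nlinarith
  have hlam0 : 0 < lam := by rw [hlam]; positivity
  calc _ ≤ 2 * (competitorCost a A κ * (r * (d1 + d2) * l) / lam + 2 * (1 / n)) := by gcongr
    _ = (2 * max (2 * K) B * competitorCost a A κ * (r * (d1 + d2) * l) + 4 * 1) / n := by
        rw [hlam]; field_simp; ring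
    _ ≤ (2 * max (2 * K) B * competitorCost a A κ * (r * (d1 + d2) * l) +
          4 * (2 * (r * (d1 + d2) * l))) / n := by gcongr
    _ = _ := by ring

end OneBit

theorem theorem4 (K B A a κ : ℝ) (hK : 0 < K) (hB : 2 ≤ B) (hA : 0 < A) (ha : 0 < a) (hκ : 1 ≤ κ) :
    ∃ C : ℝ, 0 < C ∧
      ∀ (n d1 d2 m r : ℕ) (_hN : 2 ≤ n * d1 * d2) (_hr : 1 ≤ r)
        (P : Measure (OneBit.Obs d1 d2)) (_hP : IsProbabilityMeasure P)
        (fam : OneBit.VarianceFamily) (b : ℝ)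
        (_hb : 1 / (κ * ((n * d1 * d2 : ℕ) : ℝ) ^ κ) ≤ b ∧ b ≤ κ)
        (_hm : (m : ℝ) ≤ κ * r ∨
          ((m : ℝ) ≤ κ * (d1 + d2) ∧
            (fam = OneBit.VarianceFamily.gamma ∨ b ≤ κ / ((n * d1 * d2 : ℕ) : ℝ) ^ 4)))
        (U : Matrix (Fin d1) (Fin m) ℝ) (V : Matrix (Fin d2) (Fin m) ℝ)
        (_hUV : (U, V) ∈ OneBit.factorClass d1 d2 m r A)
        (_hBayes : OneBit.IsBayesMatrix P (U * V.transpose))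
        (_hBernstein : ∀ θ ∈ OneBit.paramSet d1 d2 m B,
          OneBit.sqDist P (OneBit.toMatrix θ) (U * V.transpose) ≤
            K * (OneBit.hingeRisk P (OneBit.toMatrix θ) - OneBit.hingeRisk P (U * V.transpose)))
        (c : ℝ) (_hc : 0 < c) (_hmargin : OneBit.MarginCondition P c)
        (lam : ℝ) (_hlam : lam = n / max (2 * K) B)
        (π : Measure (OneBit.Params d1 d2 m)) (_hπ : π = OneBit.prior d1 d2 m fam a b B)
        (F : Set (Measure (OneBit.Params d1 d2 m)))
        (_hFprob : ∀ ρ ∈ F, IsProbabilityMeasure ρ)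
        (_hF : OneBit.fullyFactorized d1 d2 m ⊆ F)
        (ρVB : (Fin n → OneBit.Obs d1 d2) → Measure (OneBit.Params d1 d2 m))
        (_hVB : ∀ D, OneBit.IsVBApprox F (OneBit.gibbs π lam D) (ρVB D)),
        (∫ D, (∫ θ, OneBit.misclassRisk P (OneBit.toMatrix θ) ∂(ρVB D))
              ∂(Measure.pi fun _ : Fin n => P)) - OneBit.bayesRisk P
            ≤ C * (r * (d1 + d2) * Real.log (n * d1 * d2) / n) ∧
        (∫ D, OneBit.misclassRisk P (OneBit.meanMatrix (ρVB D))
              ∂(Measure.pi fun _ : Fin n => P)) - OneBit.bayesRisk P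
            ≤ C * (r * (d1 + d2) * Real.log (n * d1 * d2) / n) ∧
        (∫ D, OneBit.misclassRisk P (OneBit.meanMatrix (OneBit.gibbs π lam D))
              ∂(Measure.pi fun _ : Fin n => P)) - OneBit.bayesRisk P
            ≤ C * (r * (d1 + d2) * Real.log (n * d1 * d2) / n) := by
  have hM : 0 < max (2 * K) B := lt_of_lt_of_le (by linarith) (le_max_right _ _)
  have hG := OneBit.competitorCost_nonneg ha hA hκ
  refine ⟨2 * max (2 * K) B * OneBit.competitorCost a A κ + 8, by positivity, ?_⟩
  intro n d1 d2 m r hN hr P hP fam b hb hm U V hUV hBayes hbern c _ _ lam hlam π hπ F hFprob hF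
    ρVB hVB
  subst hπ
  rw [show (n : ℝ) * d1 * d2 = ((n * d1 * d2 : ℕ) : ℝ) by push_cast; ring]
  set X : ℝ := (2 * max (2 * K) B * OneBit.competitorCost a A κ + 8) *
    (r * (d1 + d2) * Real.log ((n * d1 * d2 : ℕ) : ℝ) / n) with hX
  have hprobVB : ∀ D, IsProbabilityMeasure (ρVB D) := fun D => hFprob _ (hVB D).1
  have hn : 1 ≤ n := Nat.one_le_iff_ne_zero.mpr fun h => by simp [h] at hN
  have hn0 : (0 : ℝ) < n := by exact_mod_cast hn
  -- For `n < r * (d1 + d2)` the bound is trivial: the logarithm is at least 1/2, so the summand 8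
  -- of the constant already makes the right side exceed 1.
  rcases Nat.lt_or_ge n (r * (d1 + d2)) with hlt | hrn
  · have hX1 : 1 ≤ X := by
      have hl : 1 / 2 ≤ Real.log ((n * d1 * d2 : ℕ) : ℝ) := by
        have : Real.log 2 ≤ Real.log ((n * d1 * d2 : ℕ) : ℝ) :=
          Real.log_le_log (by norm_num) (by exact_mod_cast hN)
        linarith [Real.log_two_gt_d9]
      have h1 : (n : ℝ) ≤ r * (d1 + d2) := by exact_mod_cast hlt.le
      have h2 : 1 / 2 ≤ r * (d1 + d2) * Real.log ((n * d1 * d2 : ℕ) : ℝ) / n := by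
        rw [le_div_iff₀ hn0]
        nlinarith
      have h3 : 0 ≤ 2 * max (2 * K) B * OneBit.competitorCost a A κ := by positivity
      rw [hX]
      nlinarith
    exact ⟨OneBit.misclassRisk_le_of_one_le P hX1 ρVB,
      OneBit.integral_misclassRisk_sub_le_of_one_le P hX1 _,
      OneBit.integral_misclassRisk_sub_le_of_one_le P hX1 _⟩
  · obtain ⟨hprior, ρ', hρ'F, hmain⟩ := OneBit.integral_excess_le_rate hK hB hA ha hκ hN hr hrn P
      fam hb hm hUV hBayes hbern hlam
    have hprobG : ∀ D : Fin n → OneBit.Obs d1 d2, IsProbabilityMeasure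
        (OneBit.gibbs (OneBit.prior d1 d2 m fam a b B) lam D) :=
      OneBit.isProbabilityMeasure_gibbs _ (by rw [hlam]; positivity)
    have hΘ : ∀ᵐ θ ∂(OneBit.prior d1 d2 m fam a b B), θ ∈ OneBit.paramSet d1 d2 m B :=
      ae_cond_mem (OneBit.measurableSet_paramSet B)
    obtain ⟨hac, hle⟩ := hmain ρVB hprobVB fun D => (hVB D).2 ρ' (hF hρ'F)
    -- The Gibbs posterior has divergence zero to itself, so it is at least as close as the
    -- competitor.
    obtain ⟨hac', hle'⟩ := hmain (fun D => OneBit.gibbs (OneBit.prior d1 d2 m fam a b B) lam D)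
      hprobG fun D => by rw [InformationTheory.klDiv_self]; exact zero_le
    have h1 := OneBit.misclassRisk_le_of_excess_le P hBayes ρVB (fun D => (hac D) hΘ) hle
    have h2 := OneBit.misclassRisk_le_of_excess_le P hBayes
      (fun D => OneBit.gibbs (OneBit.prior d1 d2 m fam a b B) lam D) (fun D => (hac' D) hΘ) hle'
    exact ⟨h1.1, h1.2, h2.2⟩
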